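/- Let $\mathbb F$ be a field, $n\ge 2$, and let $V$ be a vector space of dimension $2n$ over $\mathbb F$ with a non-degenerate alternating bilinear form $s$. Let $G=\mathrm{Sp}(V)$ be the group of linear automorphisms of $V$ preserving $s$. An amalgam of subgroups of $G$ is a family of subgroups of $G$ together with specified inclusion maps between some of them. Its universal completion is the group generated by the elements of all the groups in the family, subject to the relations holding in each of these groups and to the identification of every element with its images under the specified inclusions. We say that $G$ is the universal completion of the amalgam if the canonical homomorphism from the universal completion to $G$ is an isomorphism. (1) Let $\mathcal H=\{e_i,f_i\mid 1\le i\le n\}$ be a hyperbolic basis of $V$, that is, a basis with $s(e_i,e_j)=s(f_i,f_j)=0$ and $s(e_i,f_j)=\delta_{ij}$. For $1\le j\le n$ let $S^\pi_j$ be the stabilizer in $G$ of all elements of $\mathcal H\setminus\{e_j,f_j\}$ and of the subspace $\langle e_j,f_j\rangle$. For $1\le i\le n-1$ let $M^\pi_i$ be the stabilizer in $G$ of all elements of $\mathcal H\setminus\{f_i,f_{i+1}\}$ and of the subspace $\langle e_i,f_i,e_{i+1},f_{i+1}\rangle$. Then $S^\pi_j\cong \mathrm{Sp}_2(\mathbb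 F)$ and $M^\pi_i\cong\mathbb F^3$ (the additive group). Let $\mathcal A^\pi$ be the amalgam consisting of the groups $M^\pi_i$ and $S^\pi_j$ and of the subgroups $\langle M^\pi_i,M^\pi_k\rangle$ $(i\neq k)$, $\langle S^\pi_j,S^\pi_l\rangle$ $(j\ne l)$ and $\langle M^\pi_i,S^\pi_j\rangle$ of $G$ that they generate pairwise, with the inclusions of the $M^\pi_i$ and $S^\pi_j$ in these. If $|\mathbb F|>2$, then $G$ is the universal completion of $\mathcal A^\pi$. (2) For a subspace $U$ of $V$ put $\mathrm{Rad}(U)=U\cap U^\perp$. The quasi-Phan geometry $\Gamma$ has as objects the subspaces $U$ with $0\neq U\ne V$ and $\dim \mathrm{Rad}(U)\le 1$; the type of $U$ is $\dim U$. Two objects $X,Y$ are incident if $X=Y$, or $X\subseteq Y$ and $X\cap\mathrm{Rad}(Y)=0$, or $Y\subseteq X$ and $Y\cap \mathrm{Rad}(X)=0$. A chamber of $\Gamma$ is a set of pairwise incident objects in which all types $1,\dots,2n-1$ occur. Let $C$ be any chamber of $\Gamma$, and let $\mathcal A$ be the amalgam of maximal parabolics of $G$ with respect to $C$: the stabilizers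 $G_X$ in $G$ of the elements $X\in C$, glued along their pairwise intersections $G_X\cap G_Y$. Then, over any field $\mathbb F$, $G$ is the universal completion of $\mathcal A$. -/

import Mathlib

open scoped Pointwise

/-! ### Amalgams of subgroups and their universal completion -/

/-- The relators of the universal completion of an amalgam of subgroups `H i` of `G`, indexed by a
preordered set, whose maps are the inclusions `H i → H j` for `i ≤ j`: all relations that hold
inside one of the groups `H i`, and the identification of `a ∈ H i` with its image in `H j`. -/
def amalgamRelators {ι G : Type*} [Preorder ι] [Group G] (H : ι →o Subgroup G) :
    Set (FreeGroup (Σ i, H i)) :=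
  {w | ∃ (i : ι) (a b : H i),
      w = FreeGroup.of ⟨i, a⟩ * FreeGroup.of ⟨i, b⟩ * (FreeGroup.of ⟨i, a * b⟩)⁻¹} ∪
  {w | ∃ (i j : ι) (hij : i ≤ j) (a : H i),
      w = FreeGroup.of ⟨i, a⟩ *
        (FreeGroup.of ⟨j, Subgroup.inclusion (H.monotone hij) a⟩)⁻¹}

/-- The universal completion of an amalgam of subgroups: words in the elements of the groups of
the amalgam, modulo the relations of the amalgam. -/
abbrev UniversalCompletion {ι G : Type*} [Preorder ι] [Group G] (H : ι →o Subgroup G) : Type _ :=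
  PresentedGroup (amalgamRelators H)

/-- The canonical homomorphism from the universal completion to the ambient group, which is the
inclusion on each group of the amalgam. -/
def UniversalCompletion.toAmbient {ι G : Type*} [Preorder ι] [Group G] (H : ι →o Subgroup G) :
    UniversalCompletion H →* G :=
  PresentedGroup.toGroup (f := fun x : Σ i, H i => (x.2 : G)) (by
    rintro w (⟨i, a, b, rfl⟩ | ⟨i, j, hij, a, rfl⟩) <;> simp)

/-- `G` is the universal completion of the amalgam `H` of subgroups of `G`. -/
def IsUniversalCompletion {ι G : Type*} [Preorder ι] [Group G] (H : ι →o Subgroup G) : Prop :=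
  Function.Bijective (UniversalCompletion.toAmbient H)

/-- The nonempty subsets with at most two elements, ordered by inclusion. -/
abbrev SmallSubset (α : Type*) : Type _ := {K : Finset α // K.Nonempty ∧ K.card ≤ 2}

/-- The amalgam formed by given subgroups `H a` and the subgroups `⟨H a, H b⟩` that they generate
pairwise, with the inclusions of `H a` and `H b` in `⟨H a, H b⟩`. -/
def joinAmalgam {α G : Type*} [Group G] (H : α → Subgroup G) : SmallSubset α →o Subgroup G where
  toFun K := ⨆ a ∈ K.1, H a
  monotone' _ _ h := biSup_mono fun _ ha => h ha

/-- The amalgam formed by given subgroups `H a` and their pairwise intersections, with the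
inclusions of `H a ∩ H b` in `H a` and `H b`. -/
def interAmalgam {α G : Type*} [Group G] (H : α → Subgroup G) :
    (SmallSubset α)ᵒᵈ →o Subgroup G where
  toFun K := ⨅ a ∈ (OrderDual.ofDual K).1, H a
  monotone' _ _ h := biInf_mono fun _ ha => h ha

section Symplectic

variable {F V : Type*} [Field F] [AddCommGroup V] [Module F V]

/-- The symplectic group `Sp(V)`: the linear automorphisms of `V` that preserve the form. -/
def Sp (s : LinearMap.BilinForm F V) : Subgroup (V ≃ₗ[F] V) where
  carrier := {g | ∀ v w, s (g v) (g w) = s v w}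
  one_mem' _ _ := rfl
  mul_mem' {g h} hg hh v w := (hg (h v) (h w)).trans (hh v w)
  inv_mem' {g} hg v w := by
    have h := hg (g⁻¹ v) (g⁻¹ w)
    rw [← LinearEquiv.mul_apply, ← LinearEquiv.mul_apply, mul_inv_cancel] at h
    exact h.symm

/-! ### The slim amalgam -/

/-- The basis `b`, with `e i = b (Sum.inl i)` and `f i = b (Sum.inr i)`, is hyperbolic. -/
structure IsHyperbolicBasis (s : LinearMap.BilinForm F V) {n : ℕ}
    (b : Module.Basis (Fin n ⊕ Fin n) F V) : Prop where
  e_e : ∀ i j, s (b (Sum.inl i)) (b (Sum.inl j)) = 0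
  f_f : ∀ i j, s (b (Sum.inr i)) (b (Sum.inr j)) = 0
  e_f : ∀ i j, s (b (Sum.inl i)) (b (Sum.inr j)) = if i = j then 1 else 0

/-- The stabilizer in `Sp(V)` of all basis vectors `b k` with `k ∉ T` and of the subspace `U`. -/
noncomputable def basisStabilizer (s : LinearMap.BilinForm F V) {κ : Type*} (b : Module.Basis κ F V)
    (T : Set κ) (U : Submodule F V) : Subgroup (Sp s) :=
  (⨅ k ∈ Tᶜ, MulAction.stabilizer (Sp s) (b k)) ⊓ MulAction.stabilizer (Sp s) U

/-- `S_j`: the stabilizer of all basis vectors but `e_j, f_j` and of `⟨e_j, f_j⟩`. -/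
noncomputable def slimS (s : LinearMap.BilinForm F V) {n : ℕ} (b : Module.Basis (Fin n ⊕ Fin n) F V)
    (j : Fin n) : Subgroup (Sp s) :=
  basisStabilizer s b {Sum.inl j, Sum.inr j}
    (Submodule.span F {b (Sum.inl j), b (Sum.inr j)})

/-- `M_i`: the stabilizer of all basis vectors but `f_i, f_{i+1}` and of
`⟨e_i, f_i, e_{i+1}, f_{i+1}⟩`. -/
noncomputable def slimM (s : LinearMap.BilinForm F V) {n : ℕ} (b : Module.Basis (Fin n ⊕ Fin n) F V)
    (i : Fin (n - 1)) : Subgroup (Sp s) :=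
  let i₀ : Fin n := ⟨i, by omega⟩
  let i₁ : Fin n := ⟨i + 1, by omega⟩
  basisStabilizer s b {Sum.inr i₀, Sum.inr i₁}
    (Submodule.span F {b (Sum.inl i₀), b (Sum.inr i₀), b (Sum.inl i₁), b (Sum.inr i₁)})

/-- The slim amalgam: the groups `M_i` and `S_j` and the subgroups `⟨M_i, M_k⟩`, `⟨S_j, S_l⟩`,
`⟨M_i, S_j⟩` that they generate pairwise. -/
noncomputable def slimAmalgam (s : LinearMap.BilinForm F V) {n : ℕ} (b : Module.Basis (Fin n ⊕ Fin n) F V) :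
    SmallSubset (Fin (n - 1) ⊕ Fin n) →o Subgroup (Sp s) :=
  joinAmalgam (Sum.elim (slimM s b) (slimS s b))

/-! ### The quasi-Phan geometry -/

/-- The radical `U ∩ U^⊥` of a subspace. -/
def radical (s : LinearMap.BilinForm F V) (U : Submodule F V) : Submodule F V :=
  U ⊓ s.orthogonal U

/-- The objects of the quasi-Phan geometry: the proper nonzero subspaces that meet the radical of
`V` trivially and whose own radical has dimension at most `1`. The type is the dimension. -/
structure IsQuasiPhanObject (s : LinearMap.BilinForm F V) (U : Submodule F V) : Prop where
  ne_bot : U ≠ ⊥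
  ne_top : U ≠ ⊤
  disjoint_radical : Disjoint U (radical s ⊤)
  finrank_radical_le : Module.finrank F (radical s U) ≤ 1

/-- Incidence in the quasi-Phan geometry: two objects are equal, or one of them is contained in
the other and meets the radical of the other trivially. -/
def QuasiPhanIncident (s : LinearMap.BilinForm F V) (X Y : Submodule F V) : Prop :=
  X = Y ∨ (X ≤ Y ∧ Disjoint X (radical s Y)) ∨ (Y ≤ X ∧ Disjoint Y (radical s X))

/-- A chamber of the quasi-Phan geometry: a set of pairwise incident objects in which every type
`1, …, dim V - 1` occurs. -/
structure IsChamber (s : LinearMap.BilinForm F V) (C : Set (Submodule F V)) : Prop where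
  isObject : ∀ X ∈ C, IsQuasiPhanObject s X
  incident : ∀ X ∈ C, ∀ Y ∈ C, QuasiPhanIncident s X Y
  types : ∀ d, 0 < d → d < Module.finrank F V → ∃ X ∈ C, Module.finrank F X = d

/-- The amalgam of the maximal parabolic subgroups with respect to a chamber `C`, that is, of the
stabilizers in `Sp(V)` of the elements of `C`, glued along their pairwise intersections. -/
def parabolicAmalgam (s : LinearMap.BilinForm F V) (C : Set (Submodule F V)) :
    (SmallSubset C)ᵒᵈ →o Subgroup (Sp s) :=
  interAmalgam fun X : C => MulAction.stabilizer (Sp s) (X : Submodule F V)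

end Symplectic

/-! ### Transvections and transitivity of symplectic groups. -/

section SymplecticBasics

variable {F V : Type*} [Field F] [AddCommGroup V] [Module F V] {s : LinearMap.BilinForm F V}

/-! Both completion statements rest on one fact: in the graph on vectors in which non-orthogonal
vectors are joined, every closed walk decomposes into triangles. Let `K` be the completion with its
map `φ` to `Sp s`. Suppose a subgroup `H` of `K` fixes a vector `e` and lifts enough of its
stabilizer, and `S` lifts the symplectic group of a hyperbolic plane `⟨e, f⟩`. A word in `H` and `S`
that fixes `e` is a closed walk at `e`, so it lies in `H` as soon as triangles can be closed up in
`K`. Up to `H`, a triangle lies in a degenerate space `⟨e, f, r⟩` with radical spanned by `r`, and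
there a third subgroup `W` takes care of it. This is `mem_of_smul_eq_of_edges` and
`TriangleData.mem_of_smul_eq`. If `φ` is injective on `H`, it is then injective on `H ⊔ S`.
Surjectivity follows from `le_of_stabilizer_le`, since any two vertices have a common neighbour.

For a chamber, the members of dimensions `1`, `2n - 2` and `2n - 1` supply the data: `H` comes from
the stabilizer of the hyperplane `e^⊥`, `S` from that of `⟨e, f⟩^⊥`, and `W` from that of the line
`⟨r⟩`. The map `φ` is injective on each lifted parabolic from the start, so no condition on the
field arises.

For the slim amalgam one inducts on the level `m`, showing that the subgroup generated by the lifts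
with indices up to `m` maps isomorphically onto the symplectic group of `⟨e_0, f_0, …, e_m, f_m⟩`.
Here `H` is generated by level `m` and `M_m`, and its faithfulness has to be proved. Conjugating one
element of `M_m` by level `m` gives lifts `q v` of the Heisenberg group of `e_{m+1}`. These multiply
correctly for non-orthogonal arguments because such a pair can be moved into the plane `⟨e_m, f_m⟩`,
where an amalgam relation applies. For orthogonal `u, v` one splits `u` so that only non-orthogonal
products occur; this is the only place where `|F| > 2` enters (`IsHeisenbergLift.q_mul`). A normal
form then gives faithfulness of `H`, and the triangle argument passes to level `m + 1`. -/

theorem Sp.form_smul (g : Sp s) (v w : V) : s (g • v) (g • w) = s v w := g.2 v w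

theorem Sp.form_smul_left (g : Sp s) (v w : V) : s (g • v) w = s v (g⁻¹ • w) := by
  rw [← Sp.form_smul g v (g⁻¹ • w), smul_inv_smul]

theorem Sp.form_smul_right (g : Sp s) (v w : V) : s v (g • w) = s (g⁻¹ • v) w := by
  rw [← Sp.form_smul g (g⁻¹ • v) w, smul_inv_smul]

theorem Sp.ext_smul {g h : Sp s} (H : ∀ v : V, g • v = h • v) : g = h :=
  Subtype.ext (LinearEquiv.ext H)

theorem LinearMap.BilinForm.IsAlt.swap (hs : s.IsAlt) (v w : V) : s v w = -s w v :=
  (LinearMap.IsAlt.neg hs w v).symm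

/-- A pair of mutually inverse linear maps, one of which preserves the form. -/
theorem Sp.exists_of_inverse (L L' : V →ₗ[F] V) (h₁ : ∀ v, L' (L v) = v) (h₂ : ∀ v, L (L' v) = v)
    (h : ∀ v w, s (L v) (L w) = s v w) : ∃ g : Sp s, ∀ v, g • v = L v :=
  ⟨⟨LinearEquiv.ofLinearMap L L' (LinearMap.ext h₂) (LinearMap.ext h₁), h⟩, fun _ => rfl⟩

theorem Sp.exists_of_isometry [FiniteDimensional F V] (hnd : s.Nondegenerate) (L : V →ₗ[F] V)
    (h : ∀ v w, s (L v) (L w) = s v w) : ∃ g : Sp s, ∀ v, g • v = L v := by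
  have hinj : Function.Injective L := by
    rw [injective_iff_map_eq_zero]
    intro v hv
    refine hnd.1 v fun w => ?_
    rw [← h, hv, map_zero, LinearMap.zero_apply]
  exact ⟨⟨LinearEquiv.ofInjectiveEndo L hinj, h⟩, fun _ => rfl⟩

theorem Sp.exists_transvection (hs : s.IsAlt) (x : V) (a : F) :
    ∃ g : Sp s, ∀ y, g • y = y + (a * s y x) • x := by
  let L : F → V →ₗ[F] V := fun a => LinearMap.id + a • (s.flip x).smulRight x
  have hL : ∀ a y, L a y = y + (a * s y x) • x := fun a y => by simp [L, smul_smul]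
  obtain ⟨g, hg⟩ := Sp.exists_of_inverse (s := s) (L a) (L (-a))
    (fun v => by simp only [hL, map_add, map_smul, LinearMap.add_apply, LinearMap.smul_apply,
      hs.self_eq_zero, smul_eq_mul]; module)
    (fun v => by simp only [hL, map_add, map_smul, LinearMap.add_apply, LinearMap.smul_apply,
      hs.self_eq_zero, smul_eq_mul]; module)
    (fun v w => by
      simp only [hL, map_add, map_smul, LinearMap.add_apply, LinearMap.smul_apply,
        hs.self_eq_zero, smul_eq_mul]
      rw [hs.swap x w]; ring)
  exact ⟨g, fun y => by rw [hg, hL]⟩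

theorem Sp.exists_heisenberg (hs : s.IsAlt) {e v : V} (hev : s e v = 0) :
    ∃ g : Sp s, ∀ y, g • y = y + s y e • v + s y v • e := by
  have hve : s v e = 0 := by rw [hs.swap, hev, neg_zero]
  let L : V → V →ₗ[F] V := fun v =>
    LinearMap.id + (s.flip e).smulRight v + (s.flip v).smulRight e
  have hL : ∀ v y, L v y = y + s y e • v + s y v • e := fun v y => by simp [L]
  obtain ⟨g, hg⟩ := Sp.exists_of_inverse (s := s) (L v) (L (-v))
    (fun y => by simp only [hL, map_add, map_smul, LinearMap.add_apply, LinearMap.smul_apply,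
      hs.self_eq_zero, smul_eq_mul, map_neg, hev, hve]; module)
    (fun y => by simp only [hL, map_add, map_smul, LinearMap.add_apply, LinearMap.smul_apply,
      hs.self_eq_zero, smul_eq_mul, map_neg, LinearMap.neg_apply, hev, hve]; module)
    (fun y z => by
      simp only [hL, map_add, map_smul, LinearMap.add_apply, LinearMap.smul_apply,
        hs.self_eq_zero, smul_eq_mul, hev, hve]
      rw [hs.swap v z, hs.swap e z]; ring)
  exact ⟨g, fun y => by rw [hg, hL]⟩

/-- Two functionals `s u` and `s v` that do not vanish on `Y` have a common non-zero. -/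
theorem exists_common_ne_zero {Y : Submodule F V} {u v : V} (hu : ∃ w ∈ Y, s u w ≠ 0)
    (hv : ∃ w ∈ Y, s v w ≠ 0) : ∃ w ∈ Y, s u w ≠ 0 ∧ s v w ≠ 0 := by
  obtain ⟨x, hx, hux⟩ := hu
  obtain ⟨y, hy, hvy⟩ := hv
  by_cases h₁ : s v x = 0
  · by_cases h₂ : s u y = 0
    · exact ⟨x + y, add_mem hx hy, by simpa [h₂], by simpa [h₁]⟩
    · exact ⟨y, hy, h₂, hvy⟩
  · exact ⟨x, hx, hux, h₁⟩

/-- A subspace on which no nonzero vector of it is orthogonal to all of it. -/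
def IsNondegenerateOn (s : LinearMap.BilinForm F V) (Y : Submodule F V) : Prop :=
  ∀ u ∈ Y, u ≠ 0 → ∃ v ∈ Y, s u v ≠ 0

/-- The elements of `Sp(V)` that act trivially on the vectors orthogonal to `Y`. -/
def fixOrthogonal (s : LinearMap.BilinForm F V) (Y : Submodule F V) : Subgroup (Sp s) where
  carrier := {g | ∀ v, (∀ y ∈ Y, s v y = 0) → g • v = v}
  one_mem' v _ := one_smul _ v
  mul_mem' {g h} hg hh v hv := by rw [mul_smul, hh v hv, hg v hv]
  inv_mem' {g} hg v hv := by rw [inv_smul_eq_iff, hg v hv]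

theorem mem_fixOrthogonal_of_transvection {Y : Submodule F V} {g : Sp s} {x : V} {a : F}
    (hx : x ∈ Y) (hg : ∀ y, g • y = y + (a * s y x) • x) : g ∈ fixOrthogonal s Y := fun v hv => by
  rw [hg, hv x hx, mul_zero, zero_smul, add_zero]

/-- The transvection in the direction `v - u`, scaled by `(s u v)⁻¹`, does it. -/
theorem exists_fixOrthogonal_smul_of_ne (hs : s.IsAlt) {Y : Submodule F V} {u v : V} (hu : u ∈ Y)
    (hv : v ∈ Y) (huv : s u v ≠ 0) :
    ∃ g ∈ fixOrthogonal s Y, g • u = v ∧ ∀ w, s w (v - u) = 0 → g • w = w := by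
  obtain ⟨g, hg⟩ := Sp.exists_transvection hs (v - u) (s u v)⁻¹
  refine ⟨g, mem_fixOrthogonal_of_transvection (sub_mem hv hu) hg, ?_, fun w hw => ?_⟩
  · rw [hg, map_sub, hs.self_eq_zero, sub_zero, inv_mul_cancel₀ huv, one_smul, add_sub_cancel]
  · rw [hg, hw, mul_zero, zero_smul, add_zero]

theorem exists_fixOrthogonal_smul (hs : s.IsAlt) {Y : Submodule F V} (hY : IsNondegenerateOn s Y)
    {u v : V} (hu : u ∈ Y) (hv : v ∈ Y) (hu0 : u ≠ 0) (hv0 : v ≠ 0) :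
    ∃ g ∈ fixOrthogonal s Y, g • u = v := by
  obtain ⟨w, hw, huw, hvw⟩ := exists_common_ne_zero (hY u hu hu0) (hY v hv hv0)
  obtain ⟨g, hg, hgu, -⟩ := exists_fixOrthogonal_smul_of_ne hs hu hw huw
  obtain ⟨h, hh, hhv, -⟩ := exists_fixOrthogonal_smul_of_ne hs hv hw hvw
  exact ⟨h⁻¹ * g, mul_mem (inv_mem hh) hg, by rw [mul_smul, hgu, ← hhv, inv_smul_smul]⟩

/-- If `s u v ≠ 0`, the transvection along `v - u` fixes `e`, because `v - u` is orthogonal to `e`.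
If `s u v = 0`, one passes through `v + e`, which is not orthogonal to `u`, and a transvection along
`e` brings `v + e` back to `v`. -/
theorem exists_fixOrthogonal_smul_fix (hs : s.IsAlt) {Y : Submodule F V} {e u v : V} (he : e ∈ Y)
    (hu : u ∈ Y) (hv : v ∈ Y) (heu : s e u ≠ 0) (huv : s e u = s e v) :
    ∃ g ∈ fixOrthogonal s Y, g • e = e ∧ g • u = v := by
  have key : ∀ v ∈ Y, s e u = s e v → s u v ≠ 0 →
      ∃ g ∈ fixOrthogonal s Y, g • e = e ∧ g • u = v := fun v hv huv h => by
    obtain ⟨g, hg, hgu, hgw⟩ := exists_fixOrthogonal_smul_of_ne hs hu hv h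
    exact ⟨g, hg, hgw e (by rw [map_sub, huv, sub_self]), hgu⟩
  by_cases h : s u v = 0
  · obtain ⟨g, hg, hge, hgu⟩ := key (v + e) (add_mem hv he)
      (by rw [map_add, hs.self_eq_zero, add_zero, huv])
      (by rw [map_add, h, zero_add, hs.swap]; simpa using heu)
    obtain ⟨t, ht⟩ := Sp.exists_transvection hs e (s e u)⁻¹
    refine ⟨t * g, mul_mem (mem_fixOrthogonal_of_transvection he ht) hg, ?_, ?_⟩
    · rw [mul_smul, hge, ht, hs.self_eq_zero, mul_zero, zero_smul, add_zero]
    · rw [mul_smul, hgu, ht, map_add, LinearMap.add_apply, hs.self_eq_zero, add_zero, hs.swap v e,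
        ← huv, mul_neg, inv_mul_cancel₀ heu, neg_smul, one_smul, add_neg_cancel_right]
  · exact key v hv huv h

end SymplecticBasics

/-! ### Triangle decomposition of closed walks, and stabilizers in a group mapping to `Sp s`. -/

section Criterion

variable {F V : Type*} [Field F] [AddCommGroup V] [Module F V] {s : LinearMap.BilinForm F V}
  {K : Type*} [Group K] {φ : K →* Sp s}

/-- Simple connectedness of the graph of non-orthogonality, as a statement on stabilizers: `D` is
the set of elements of `K` that move the base vertex `e` along a lifted edge. -/
theorem mem_of_smul_eq_of_edges (hs : s.IsAlt) {e : V} {Y : Submodule F V} (he : e ∈ Y)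
    {H : Subgroup K} {D : Set K} (hDY : ∀ d ∈ D, ∀ v ∈ Y, φ d • v ∈ Y)
    (hadj : ∀ d ∈ D, s e (φ d • e) ≠ 0) (hinv : ∀ d ∈ D, d⁻¹ ∈ D)
    (hDH : ∀ d ∈ D, ∀ h ∈ H, d * h ∈ D)
    (hex : ∀ v ∈ Y, s e v ≠ 0 → ∃ d ∈ D, φ d • e = v)
    (huniq : ∀ d ∈ D, ∀ d' ∈ D, φ d • e = φ d' • e → d⁻¹ * d' ∈ H)
    (htri : ∀ d ∈ D, ∀ d' ∈ D, s (φ d • e) (φ d' • e) ≠ 0 → d⁻¹ * d' ∈ D)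
    (hne : D.Nonempty) {k : K} (hk : k ∈ Subgroup.closure (H ∪ D)) (hke : φ k • e = e) :
    k ∈ H := by
  have hmul : ∀ d ∈ D, ∀ d' ∈ D, s e (φ (d * d') • e) ≠ 0 → d * d' ∈ D := fun d hd d' hd' h => by
    have := htri d⁻¹ (hinv d hd) d' hd'
    rw [inv_inv] at this
    refine this ?_
    rwa [map_inv, Sp.form_smul_left, inv_inv, smul_smul, ← map_mul]
  -- Walks of length three shorten to length two. Write the walk as `e, a, b, c`. If `e, b` or `a,
  -- c` are adjacent, a single triangle suffices.
  have hDDD : ∀ d₁ ∈ D, ∀ d₂ ∈ D, ∀ d₃ ∈ D, ∃ d ∈ D, ∃ d' ∈ D, d₁ * d₂ * d₃ = d * d' := by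
    intro d₁ h₁ d₂ h₂ d₃ h₃
    by_cases hb : s e (φ (d₁ * d₂) • e) = 0
    swap
    · exact ⟨_, hmul _ h₁ _ h₂ hb, _, h₃, rfl⟩
    by_cases hc : s e (φ (d₂ * d₃) • e) = 0
    swap
    · exact ⟨_, h₁, _, hmul _ h₂ _ h₃ hc, mul_assoc _ _ _⟩
    have hab : s (φ d₁ • e) (φ (d₁ * d₂) • e) ≠ 0 := by
      rw [map_mul, mul_smul, Sp.form_smul]; exact hadj _ h₂
    have hbc : s (φ (d₁ * d₂) • e) (φ (d₁ * d₂ * d₃) • e) ≠ 0 := by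
      rw [map_mul _ (d₁ * d₂), mul_smul, Sp.form_smul]; exact hadj _ h₃
    have hac : s (φ d₁ • e) (φ (d₁ * d₂ * d₃) • e) = 0 := by
      rw [mul_assoc, map_mul, mul_smul, Sp.form_smul]; exact hc
    have haY := hDY _ h₁ _ he
    have hbY : φ (d₁ * d₂) • e ∈ Y := by
      rw [map_mul, mul_smul]; exact hDY _ h₁ _ (hDY _ h₂ _ he)
    -- In the remaining case `b ⟂ e` and `c ⟂ a`, so `a + b` is adjacent to all of `e, a, b, c`. It
    -- cuts the walk into three triangles and leaves the walk `e, a + b, c`.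
    obtain ⟨d, hd, hde⟩ := hex (φ d₁ • e + φ (d₁ * d₂) • e) (add_mem haY hbY)
      (by rw [map_add, hb, add_zero]; exact hadj _ h₁)
    have hx : ∀ k, s e (φ (d⁻¹ * k) • e) = s (φ d₁ • e + φ (d₁ * d₂) • e) (φ k • e) := fun k => by
      rw [← hde, map_mul, mul_smul, map_inv, Sp.form_smul_left]
    have k₁ : d⁻¹ * d₁ ∈ D := hmul _ (hinv _ hd) _ h₁ (by
      rw [hx, map_add, LinearMap.add_apply, hs.self_eq_zero, zero_add, hs.swap]
      exact neg_ne_zero.mpr hab)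
    have k₂ : d⁻¹ * (d₁ * d₂) ∈ D := by
      rw [← mul_assoc]
      refine hmul _ k₁ _ h₂ ?_
      rw [mul_assoc, hx, map_add, LinearMap.add_apply, hs.self_eq_zero, add_zero]
      exact hab
    have k₃ : d⁻¹ * (d₁ * d₂ * d₃) ∈ D := by
      rw [← mul_assoc]
      refine hmul _ k₂ _ h₃ ?_
      rw [mul_assoc, hx, map_add, LinearMap.add_apply, hac, zero_add]
      exact hbc
    exact ⟨d, hd, _, k₃, by group⟩
  have hHD : ∀ h ∈ H, ∀ d ∈ D, h * d ∈ D := fun h hh d hd => by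
    simpa using hinv _ (hDH _ (hinv _ hd) _ (inv_mem hh))
  -- Every word thus reduces to at most two edges. One edge cannot be closed, as `s e e = 0`; two
  -- edges that close up are the same edge traversed back and forth, so their product lies in `H`.
  have hall : k ∈ D ∨ ∃ d ∈ D, ∃ d' ∈ D, k = d * d' := by
    have step : ∀ x y : K, y ∈ (H : Set K) ∪ D → (x ∈ D ∨ ∃ d ∈ D, ∃ d' ∈ D, x = d * d') →
        (x * y ∈ D ∨ ∃ d ∈ D, ∃ d' ∈ D, x * y = d * d') := by
      rintro x y (hy | hy) (hx | ⟨d, hd, d', hd', rfl⟩)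
      · exact .inl (hDH _ hx _ hy)
      · exact .inr ⟨d, hd, d' * y, hDH _ hd' _ hy, mul_assoc _ _ _⟩
      · exact .inr ⟨x, hx, y, hy, rfl⟩
      · exact .inr (hDDD _ hd _ hd' _ hy)
    clear hke
    induction hk using Subgroup.closure_induction_right with
    | one =>
      obtain ⟨d, hd⟩ := hne
      exact .inr ⟨d, hd, d⁻¹, hinv _ hd, by simp⟩
    | mul_right x _ y hy ih => exact step x y hy ih
    | mul_inv_cancel x _ y hy ih =>
      refine step x y⁻¹ ?_ ih
      rcases hy with hy | hy
      · exact .inl (inv_mem hy)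
      · exact .inr (hinv _ hy)
  rcases hall with hk | ⟨d, hd, d', hd', rfl⟩
  · exact absurd (by rw [hke, hs.self_eq_zero]) (hadj _ hk)
  · have := huniq _ (hinv _ hd) _ hd' (by
      rw [map_inv, inv_smul_eq_iff, smul_smul, ← map_mul, hke])
    rwa [inv_inv] at this

/-- Lifts of the stabilizer of `e`, of the symplectic group of the hyperbolic plane `⟨e, f⟩`, and of
enough symplectic maps of the degenerate space `⟨e, f, r⟩`: the data that determine a group with a
map to `Sp(V)` up to the kernel of that map on the stabilizer of `e`. -/
structure TriangleData (φ : K →* Sp s) (Y : Submodule F V) (e f r : V) (H S W : Subgroup K) :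
    Prop where
  e_mem : e ∈ Y
  f_mem : f ∈ Y
  e_f : s e f = 1
  e_r : s e r = 0
  f_r : s f r = 0
  H_mem : ∀ h ∈ H, ∀ v ∈ Y, φ h • v ∈ Y
  H_fix : ∀ h ∈ H, φ h • e = e
  H_trans : ∀ v ∈ Y, s e v = 1 → ∃ h ∈ H, φ h • f = v
  H_trans_fix : ∀ v ∈ Y, s e v = 0 → s f v = 0 → v ≠ 0 → ∃ h ∈ H, φ h • f = f ∧ φ h • r = v
  H_comm : ∀ h ∈ H, φ h • f = f → ∀ σ ∈ S, Commute h σ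
  S_mem : ∀ σ ∈ S, ∀ v ∈ Y, φ σ • v ∈ Y
  S_plane : ∀ σ ∈ S, ∃ a b : F, φ σ • e = a • e + b • f
  S_trans : ∀ a : F, a ≠ 0 → ∃ σ ∈ S, φ σ • e = a • f
  S_shear : ∀ a : F, ∃ σ ∈ S, φ σ • e = e ∧ φ σ • f = f + a • e
  S_fix : ∀ σ ∈ S, φ σ • e = e → σ ∈ H
  S_le_W : S ≤ W
  W_space : ∀ k ∈ W, ∃ a b c : F, φ k • e = a • e + b • f + c • r
  W_fix : ∀ k ∈ W, φ k • e = e → k ∈ H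
  W_trans : ∀ a b : F, ∃ k ∈ W, φ k • e = e ∧ φ k • f = a • e + f + b • r

namespace TriangleData

variable {Y : Submodule F V} {e f r : V} {H S W : Subgroup K}

theorem exists_smul_eq (hd : TriangleData φ Y e f r H S W) {v : V} (hv : v ∈ Y) (hev : s e v ≠ 0) :
    ∃ h ∈ H, ∃ σ ∈ S, φ (h * σ) • e = v ∧ s e (φ σ • e) ≠ 0 := by
  obtain ⟨h, hh, hhv⟩ := hd.H_trans ((s e v)⁻¹ • v) (Y.smul_mem _ hv)
    (by rw [map_smul, smul_eq_mul, inv_mul_cancel₀ hev])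
  obtain ⟨σ, hσ, hσe⟩ := hd.S_trans _ hev
  refine ⟨h, hh, σ, hσ, ?_, ?_⟩
  · rw [map_mul, mul_smul, hσe, smul_comm, hhv, smul_inv_smul₀ hev]
  · rwa [hσe, map_smul, hd.e_f, smul_eq_mul, mul_one]

/-- The lifted edges from the base vertex `e`. -/
def edges (_ : TriangleData φ Y e f r H S W) : Set K :=
  {d | ∃ h ∈ H, ∃ σ ∈ S, ∃ h' ∈ H, s e (φ σ • e) ≠ 0 ∧ d = h * σ * h'}

theorem form_smul_of_mem (hd : TriangleData φ Y e f r H S W) {h : K} (hh : h ∈ H) (v : V) :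
    s e (φ h • v) = s e v := by
  conv_lhs => rw [← hd.H_fix h hh]
  exact Sp.form_smul _ _ _

/-- The endpoint of a lifted edge determines it modulo `H`. Two expressions `h₁ σ` and `h₁' σ'` with
the same endpoint differ by a shear of the plane and an element of `H` that fixes `e` and `f`. By
`H_comm` the latter slides past `σ`, and what is left lies in `S` and fixes `e`. -/
theorem edges_unique (hs : s.IsAlt) (hd : TriangleData φ Y e f r H S W) {d d' : K}
    (h : d ∈ hd.edges) (h' : d' ∈ hd.edges) (heq : φ d • e = φ d' • e) : d⁻¹ * d' ∈ H := by
  obtain ⟨h₁, hh₁, σ, hσ, h₂, hh₂, hne, rfl⟩ := h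
  obtain ⟨h₁', hh₁', σ', hσ', h₂', hh₂', hne', rfl⟩ := h'
  obtain ⟨β, α, hα⟩ := hd.S_plane σ hσ
  obtain ⟨β', α', hα'⟩ := hd.S_plane σ' hσ'
  simp only [map_mul, mul_smul, hd.H_fix _ hh₂, hd.H_fix _ hh₂'] at heq
  have heq' : φ (h₁⁻¹ * h₁') • φ σ' • e = φ σ • e := by
    rw [map_mul, map_inv, mul_smul, ← heq, inv_smul_smul]
  have hsα : s e (φ σ • e) = α := by
    rw [hα]; simp [hs.self_eq_zero, hd.e_f]
  have hsα' : s e (φ σ' • e) = α' := by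
    rw [hα']; simp [hs.self_eq_zero, hd.e_f]
  have hh : h₁⁻¹ * h₁' ∈ H := mul_mem (inv_mem hh₁) hh₁'
  obtain rfl : α = α' := by rw [← hsα, ← heq', hd.form_smul_of_mem hh, hsα']
  have hα0 : α ≠ 0 := hsα ▸ hne
  -- The shear that carries `β' e + α f` to `β e + α f`.
  obtain ⟨t, ht, hte, htf⟩ := hd.S_shear ((β - β') / α)
  have htσ : φ t • φ σ' • e = φ σ • e := by
    rw [hα, hα', smul_add, smul_comm, hte, smul_comm, htf, smul_add, smul_smul,
      mul_div_cancel₀ _ hα0]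
    module
  set x := h₁⁻¹ * h₁' * t⁻¹ with hx
  have hxH : x ∈ H := mul_mem hh (inv_mem (hd.S_fix t ht hte))
  have hxσ : φ x • φ σ • e = φ σ • e := by
    rw [hx, map_mul, mul_smul, ← htσ, map_inv, inv_smul_smul, heq', htσ]
  have hxf : φ x • f = f := by
    rw [hα, smul_add, smul_comm, hd.H_fix x hxH, add_right_inj, smul_comm] at hxσ
    exact smul_right_injective V hα0 hxσ
  have hcomm := hd.H_comm x hxH hxf σ hσ
  have hlast : σ⁻¹ * t * σ' ∈ H := by
    refine hd.S_fix _ (mul_mem (mul_mem (inv_mem hσ) ht) hσ') ?_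
    rw [map_mul, map_mul, mul_smul, mul_smul, htσ, map_inv, inv_smul_smul]
  have : (h₁ * σ * h₂)⁻¹ * (h₁' * σ' * h₂') = h₂⁻¹ * (x * (σ⁻¹ * t * σ')) * h₂' := by
    have e1 : x * (σ⁻¹ * t * σ') = σ⁻¹ * (x * t) * σ' := by
      rw [← mul_assoc, ← mul_assoc, hcomm.inv_right.eq]; group
    rw [e1, hx]; group
  rw [this]
  exact mul_mem (mul_mem (inv_mem hh₂) (mul_mem hxH hlast)) hh₂'

theorem exists_edge_of_mem (hs : s.IsAlt) (hd : TriangleData φ Y e f r H S W) {a b c : F}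
    (hne : s e (a • e + b • f + c • r) ≠ 0) :
    ∃ k ∈ W, ∃ σ ∈ S, φ k • e = e ∧ s e (φ σ • e) ≠ 0 ∧
      φ (k * σ) • e = a • e + b • f + c • r := by
  have hb : b ≠ 0 := by simpa [hs.self_eq_zero, hd.e_f, hd.e_r] using hne
  obtain ⟨k, hk, hke, hkf⟩ := hd.W_trans (b⁻¹ * a) (b⁻¹ * c)
  obtain ⟨σ, hσ, hσe⟩ := hd.S_trans b hb
  refine ⟨k, hk, σ, hσ, hke, ?_, ?_⟩
  · rwa [hσe, map_smul, hd.e_f, smul_eq_mul, mul_one]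
  · rw [map_mul, mul_smul, hσe, smul_comm, hkf, smul_add, smul_add, smul_smul, smul_smul,
      mul_inv_cancel_left₀ hb, mul_inv_cancel_left₀ hb]

/-- The image of `e` under `m` is also reached by an edge `k * σ` inside `W`. The quotient of the
two lies in `W` and fixes `e`, hence belongs to `H`. -/
theorem mem_edges_of_mem (hs : s.IsAlt) (hd : TriangleData φ Y e f r H S W) {m : K} (hm : m ∈ W)
    (hne : s e (φ m • e) ≠ 0) : m ∈ hd.edges := by
  obtain ⟨a, b, c, habc⟩ := hd.W_space m hm
  rw [habc] at hne
  obtain ⟨k, hk, σ, hσ, hke, hσe, heq⟩ := hd.exists_edge_of_mem hs hne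
  refine ⟨k, hd.W_fix k hk hke, σ, hσ, (k * σ)⁻¹ * m, hd.W_fix _ ?_ ?_, hσe, by group⟩
  · exact mul_mem (inv_mem (mul_mem hk (hd.S_le_W hσ))) hm
  · rw [map_mul, map_inv, mul_smul, habc, inv_smul_eq_iff, heq]

/-- After translation by `h₁⁻¹` the triangle is `e, σ e, w` with `σ e` in the plane `⟨e, f⟩`. An
element of `H` fixing `f` moves the component of `w` orthogonal to the plane onto `r`, and it
commutes with `σ`. So the triangle may be taken inside `⟨e, f, r⟩`, where `W` closes it. -/
theorem edges_triangle (hs : s.IsAlt) (hd : TriangleData φ Y e f r H S W) {d d' : K}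
    (h : d ∈ hd.edges) (h' : d' ∈ hd.edges) (hne : s (φ d • e) (φ d' • e) ≠ 0) :
    d⁻¹ * d' ∈ hd.edges := by
  obtain ⟨h₁, hh₁, σ, hσ, h₂, hh₂, hσe, rfl⟩ := h
  obtain ⟨h₁', hh₁', σ', hσ', h₂', hh₂', hσe', rfl⟩ := h'
  set d₀ := h₁⁻¹ * (h₁' * σ' * h₂') with hd₀
  have hd₀mem : ∀ h ∈ H, h * d₀ ∈ hd.edges := fun h hh =>
    ⟨h * h₁⁻¹ * h₁', mul_mem (mul_mem hh (inv_mem hh₁)) hh₁', σ', hσ', h₂', hh₂', hσe', by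
      rw [hd₀]; group⟩
  set w := φ d₀ • e with hw
  have hwY : w ∈ Y := by
    rw [hw, hd₀]
    simp only [map_mul, mul_smul]
    exact hd.H_mem _ (inv_mem hh₁) _ (hd.H_mem _ hh₁' _ (hd.S_mem _ hσ' _ (hd.H_mem _ hh₂' _ hd.e_mem)))
  have hwe : s e w ≠ 0 := by
    rw [hw, hd₀]
    simp only [map_mul, mul_smul]
    rwa [hd.form_smul_of_mem (inv_mem hh₁), hd.form_smul_of_mem hh₁', hd.H_fix _ hh₂']
  clear_value w
  obtain ⟨h, hh, hhf, a, b, c, habc⟩ : ∃ h ∈ H, φ h • f = f ∧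
      ∃ a b c : F, (φ h)⁻¹ • w = a • e + b • f + c • r := by
    -- The component of `w` orthogonal to the hyperbolic pair `e, f`. If it vanishes, `w` already
    -- lies in the plane and no motion is needed.
    set y := w - (s e w) • f + (s f w) • e with hy
    have hfe : s f e = -1 := by rw [hs.swap, hd.e_f]
    have hey : s e y = 0 := by rw [hy]; simp [hs.self_eq_zero, hd.e_f]
    have hfy : s f y = 0 := by rw [hy]; simp [hs.self_eq_zero, hfe]
    have hwy : w = y + (s e w) • f - (s f w) • e := by rw [hy]; module
    clear_value y
    by_cases hy0 : y = 0
    · refine ⟨1, one_mem _, by simp, -(s f w), s e w, 0, ?_⟩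
      rw [map_one, inv_one, one_smul]
      nth_rw 1 [hwy]
      rw [hy0]; module
    · have hyY : y ∈ Y := by
        rw [hy]; exact add_mem (sub_mem hwY (Y.smul_mem _ hd.f_mem)) (Y.smul_mem _ hd.e_mem)
      obtain ⟨h, hh, hhf, hhr⟩ := hd.H_trans_fix y hyY hey hfy hy0
      refine ⟨h, hh, hhf, -(s f w), s e w, 1, ?_⟩
      rw [inv_smul_eq_iff, smul_add, smul_add, smul_comm, hd.H_fix _ hh, smul_comm, hhf, one_smul,
        hhr]
      nth_rw 1 [hwy]
      module
  have hcomm := hd.H_comm h hh hhf σ hσ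
  have habc' : φ (h⁻¹ * d₀) • e = a • e + b • f + c • r := by
    rw [← habc, hw, map_mul, mul_smul, map_inv]
  have hne₀ : s e (a • e + b • f + c • r) ≠ 0 := by
    rwa [← habc, ← map_inv, hd.form_smul_of_mem (inv_mem hh)]
  obtain ⟨k, hk, τ, hτ, hke, hτe, hkτ⟩ := hd.exists_edge_of_mem hs hne₀
  have hkτmem : k * τ ∈ hd.edges := ⟨k, hd.W_fix k hk hke, τ, hτ, 1, one_mem _, hτe, by simp⟩
  have hlast := hd.edges_unique hs hkτmem (hd₀mem _ (inv_mem hh)) (hkτ.trans habc'.symm)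
  have hmW : σ⁻¹ * (k * τ) ∈ W :=
    mul_mem (inv_mem (hd.S_le_W hσ)) (mul_mem hk (hd.S_le_W hτ))
  obtain ⟨x₁, hx₁, x₂, hx₂, x₃, hx₃, hx, hxx⟩ := hd.mem_edges_of_mem hs hmW (by
    have e1 : φ (k * τ) • e = (φ h)⁻¹ • (φ h₁)⁻¹ • φ (h₁' * σ' * h₂') • e := by
      rw [hkτ, ← habc', hd₀]; simp only [map_mul, mul_smul, map_inv]
    have e2 : φ (h₁ * σ * h₂) • e = φ h₁ • φ h • φ σ • e := by
      rw [map_mul, mul_smul, hd.H_fix _ hh₂, map_mul, mul_smul, smul_smul (φ h), ← map_mul φ h,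
        hcomm.eq, map_mul, mul_smul (φ σ), hd.H_fix _ hh]
    rw [map_mul, mul_smul, e1, map_inv, ← Sp.form_smul_left, ← Sp.form_smul_left,
      ← Sp.form_smul_left, ← e2]
    exact hne)
  refine ⟨h₂⁻¹ * h * x₁, mul_mem (mul_mem (inv_mem hh₂) hh) hx₁, x₂, hx₂,
    x₃ * ((k * τ)⁻¹ * (h⁻¹ * d₀)), mul_mem hx₃ hlast, hx, ?_⟩
  calc (h₁ * σ * h₂)⁻¹ * (h₁' * σ' * h₂') = h₂⁻¹ * (σ⁻¹ * h) * (h⁻¹ * d₀) := by rw [hd₀]; group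
    _ = h₂⁻¹ * (h * σ⁻¹) * (h⁻¹ * d₀) := by rw [hcomm.inv_right.eq]
    _ = h₂⁻¹ * h * (σ⁻¹ * (k * τ)) * ((k * τ)⁻¹ * (h⁻¹ * d₀)) := by group
    _ = _ := by rw [hxx]; group

theorem mem_of_smul_eq (hs : s.IsAlt) (hd : TriangleData φ Y e f r H S W) {k : K} (hk : k ∈ H ⊔ S)
    (hke : φ k • e = e) : k ∈ H := by
  have hmem : ∀ h ∈ H, ∀ σ ∈ S, s e (φ σ • e) ≠ 0 → h * σ ∈ hd.edges := fun h hh σ hσ hne =>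
    ⟨h, hh, σ, hσ, 1, one_mem _, hne, (mul_one _).symm⟩
  obtain ⟨δ, hδ, hδe⟩ := hd.S_trans 1 one_ne_zero
  rw [one_smul] at hδe
  have hδne : s e (φ δ • e) ≠ 0 := by rw [hδe, hd.e_f]; exact one_ne_zero
  refine mem_of_smul_eq_of_edges hs hd.e_mem (H := H) (D := hd.edges) ?_ ?_ ?_ ?_ ?_
    (fun _ h _ h' => hd.edges_unique hs h h') (fun _ h _ h' => hd.edges_triangle hs h h')
    ⟨_, hmem 1 (one_mem _) δ hδ hδne⟩ ?_ hke
  · rintro _ ⟨h, hh, σ, hσ, h', hh', -, rfl⟩ v hv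
    rw [map_mul, map_mul, mul_smul, mul_smul]
    exact hd.H_mem _ hh _ (hd.S_mem _ hσ _ (hd.H_mem _ hh' _ hv))
  · rintro _ ⟨h, hh, σ, hσ, h', hh', hne, rfl⟩
    rwa [map_mul, map_mul, mul_smul, mul_smul, hd.H_fix _ hh', hd.form_smul_of_mem hh]
  · rintro _ ⟨h, hh, σ, hσ, h', hh', hne, rfl⟩
    refine ⟨h'⁻¹, inv_mem hh', σ⁻¹, inv_mem hσ, h⁻¹, inv_mem hh, ?_, by group⟩
    rw [map_inv, ← Sp.form_smul_left, hs.swap]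
    exact neg_ne_zero.mpr hne
  · rintro _ ⟨h, hh, σ, hσ, h', hh', hne, rfl⟩ x hx
    exact ⟨h, hh, σ, hσ, h' * x, mul_mem hh' hx, hne, mul_assoc _ _ _⟩
  · intro v hv hev
    obtain ⟨h, hh, σ, hσ, heq, hne⟩ := hd.exists_smul_eq hv hev
    exact ⟨_, hmem h hh σ hσ hne, heq⟩
  · have hle : H ⊔ S ≤ Subgroup.closure ((H : Set K) ∪ hd.edges) := by
      refine sup_le (fun h hh => Subgroup.subset_closure (.inl hh)) fun σ hσ => ?_
      have hcl : ∀ τ ∈ S, s e (φ τ • e) ≠ 0 → τ ∈ Subgroup.closure ((H : Set K) ∪ hd.edges) :=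
        fun τ hτ hne => Subgroup.subset_closure (.inr (by
          simpa using hmem 1 (one_mem _) τ hτ hne))
      by_cases hne : s e (φ σ • e) = 0
      -- Here `σ` maps `e` to a multiple of itself and so is not an edge. With `δ` taking `e` to
      -- `f`, both `σ * δ` and `δ` are edges.
      · rw [← mul_inv_cancel_right σ δ]
        refine mul_mem (hcl _ (mul_mem hσ hδ) ?_) (inv_mem (hcl _ hδ hδne))
        obtain ⟨a, b, hab⟩ := hd.S_plane σ hσ
        have hb : b = 0 := by
          rw [hab] at hne
          simpa [hs.self_eq_zero, hd.e_f] using hne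
        have h1 : s (φ σ • e) (φ σ • f) = 1 := by rw [Sp.form_smul, hd.e_f]
        rw [hab, hb, zero_smul, add_zero, LinearMap.map_smul, LinearMap.smul_apply, smul_eq_mul] at h1
        rw [map_mul, mul_smul, hδe]
        exact right_ne_zero_of_mul_eq_one h1
      · exact hcl σ hσ hne
    exact hle hk

end TriangleData

/-- A subgroup `L` contains `N` if it contains the stabilizer of `e` in `N` and moves `e` to all
vectors of an `N`-invariant subspace that are not orthogonal to `e`. -/
theorem le_of_stabilizer_le {e f : V} {Y : Submodule F V} {N L : Subgroup (Sp s)}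
    (he : e ∈ Y) (hf : f ∈ Y) (hef : s e f ≠ 0) (hN : ∀ g ∈ N, ∀ v ∈ Y, g • v ∈ Y)
    (hstab : ∀ g ∈ N, g • e = e → g ∈ L)
    (htrans : ∀ v ∈ Y, s e v ≠ 0 → ∃ l ∈ L ⊓ N, l • e = v) : N ≤ L := by
  have key : ∀ g ∈ N, s e (g • e) ≠ 0 → g ∈ L := fun g hg hne => by
    obtain ⟨l, ⟨hl, hlN⟩, hle⟩ := htrans _ (hN g hg e he) hne
    rw [← mul_inv_cancel_left l g]
    exact mul_mem hl (hstab _ (mul_mem (inv_mem hlN) hg) (by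
      rw [mul_smul, ← hle, inv_smul_smul]))
  intro g hg
  -- A common neighbour of `e` and `g • e`: moving it to `e` by an element of `L` reduces to the
  -- case treated in `key`, applied to an inverse.
  obtain ⟨w, hw, hew, hgw⟩ := exists_common_ne_zero (s := s) (Y := Y) (u := g • e) (v := e)
    ⟨g • f, hN g hg f hf, by rwa [Sp.form_smul]⟩ ⟨f, hf, hef⟩
  obtain ⟨l, ⟨hl, hlN⟩, hle⟩ := htrans w hw hgw
  rw [← inv_mul_cancel_left l⁻¹ g, inv_inv]
  have hx : l⁻¹ * g ∈ N := mul_mem (inv_mem hlN) hg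
  refine mul_mem hl ?_
  rw [← inv_inv (l⁻¹ * g)]
  refine inv_mem (key _ (inv_mem hx) ?_)
  rwa [mul_inv_rev, inv_inv, mul_smul, hle, ← Sp.form_smul_left]

end Criterion

/-! ### Relations between transvections and Heisenberg maps. -/

section Heisenberg

variable {F V : Type*} [Field F] [AddCommGroup V] [Module F V] {s : LinearMap.BilinForm F V}

/-- `g` is the transvection `y ↦ y + a s(y, x) x`. -/
def IsTransvection (x : V) (a : F) (g : Sp s) : Prop := ∀ y, g • y = y + (a * s y x) • x

/-- `g` is the map `y ↦ y + s(y, e) v + s(y, v) e`. -/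
def IsHeisenberg (e v : V) (g : Sp s) : Prop := ∀ y, g • y = y + s y e • v + s y v • e

theorem IsTransvection.unique {x : V} {a : F} {g h : Sp s} (hg : IsTransvection x a g)
    (hh : IsTransvection x a h) : g = h := Sp.ext_smul fun y => by rw [hg, hh]

theorem IsHeisenberg.unique {e v : V} {g h : Sp s} (hg : IsHeisenberg e v g)
    (hh : IsHeisenberg e v h) : g = h := Sp.ext_smul fun y => by rw [hg, hh]

theorem IsTransvection.mul (hs : s.IsAlt) {x : V} {a b : F} {g h : Sp s} (hg : IsTransvection x a g)
    (hh : IsTransvection x b h) : IsTransvection x (a + b) (g * h) := fun y => by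
  rw [mul_smul, hh, hg, map_add, map_smul, LinearMap.add_apply, LinearMap.smul_apply,
    hs.self_eq_zero]
  module

theorem IsTransvection.commute {x : V} {a : F} {g h : Sp s} (hg : IsTransvection x a g)
    (hh : h • x = x) : Commute h g := Sp.ext_smul fun y => by
  have : s (h • y) x = s y x := by
    conv_lhs => rw [← hh]
    exact Sp.form_smul _ _ _
  rw [mul_smul, mul_smul, hg, hg, this, smul_add, smul_comm, hh]

theorem IsHeisenberg.conj {e v : V} {g h : Sp s} (hg : IsHeisenberg e v g) (hh : h • e = e) :
    IsHeisenberg e (h • v) (h * g * h⁻¹) := fun y => by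
  have h1 : s (h⁻¹ • y) e = s y e := by rw [Sp.form_smul_left, inv_inv, hh]
  have h2 : s (h⁻¹ • y) v = s y (h • v) := by rw [Sp.form_smul_left, inv_inv]
  rw [mul_smul, mul_smul, hg, smul_add, smul_add, smul_inv_smul, h1, h2, smul_comm h, smul_comm h, hh]

/-- The Heisenberg maps form a section of an extension by the transvections along `e`, with cocycle
`s v u`. No division by two occurs, so characteristic two is included. -/
theorem IsHeisenberg.mul (hs : s.IsAlt) {e u v : V} {g h k t : Sp s} (hg : IsHeisenberg e u g)
    (hh : IsHeisenberg e v h) (hk : IsHeisenberg e (u + v) k) (ht : IsTransvection e (s v u) t)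
    (hu : s e u = 0) (hv : s e v = 0) : g * h = k * t := Sp.ext_smul fun y => by
  have hve : s v e = 0 := by rw [hs.swap, hv, neg_zero]
  rw [mul_smul, mul_smul, hh, hg, ht, hk]
  simp only [map_add, map_smul, LinearMap.add_apply, LinearMap.smul_apply, hs.self_eq_zero,
    smul_eq_mul, hu, hv, hve]
  module

end Heisenberg

/-! ### Linear algebra of hyperbolic systems. -/

section HyperbolicSystem

variable {F V : Type*} [Field F] [AddCommGroup V] [Module F V] {s : LinearMap.BilinForm F V}

/-- The first `n` terms of the sequences `e` and `f` form a hyperbolic basis. -/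
structure IsHyperbolicSystem (s : LinearMap.BilinForm F V) (n : ℕ) (e f : ℕ → V) : Prop where
  e_e : ∀ i j, i < n → j < n → s (e i) (e j) = 0
  f_f : ∀ i j, i < n → j < n → s (f i) (f j) = 0
  e_f : ∀ i j, i < n → j < n → s (e i) (f j) = if i = j then 1 else 0
  separating : ∀ v, (∀ k < n, s v (e k) = 0 ∧ s v (f k) = 0) → v = 0

/-- `g` fixes all `e k` and `f k` with `k < n` and `k ≠ j`. -/
def FixesOffPlane (n : ℕ) (e f : ℕ → V) (j : ℕ) (g : Sp s) : Prop :=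
  ∀ k < n, k ≠ j → g • e k = e k ∧ g • f k = f k

/-- `g` fixes all `e k` with `k < n` and all `f k` with `k < n` and `k ≠ i, i + 1`. -/
def FixesOffPair (n : ℕ) (e f : ℕ → V) (i : ℕ) (g : Sp s) : Prop :=
  ∀ k < n, g • e k = e k ∧ (k ≠ i → k ≠ i + 1 → g • f k = f k)

/-- `g` fixes all `e k` and `f k` with `m < k < n`. -/
def FixesAbove (n : ℕ) (e f : ℕ → V) (m : ℕ) (g : Sp s) : Prop :=
  ∀ k < n, m < k → g • e k = e k ∧ g • f k = f k

/-- The subspace spanned by `e k` and `f k` for `k ≤ m`, given as an orthogonal complement. -/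
def levelSpace (s : LinearMap.BilinForm F V) (n : ℕ) (e f : ℕ → V) (m : ℕ) : Submodule F V where
  carrier := {v | ∀ k < n, m < k → s v (e k) = 0 ∧ s v (f k) = 0}
  zero_mem' := by simp
  add_mem' {v w} hv hw k hk hm := by simp [hv k hk hm, hw k hk hm]
  smul_mem' c v hv k hk hm := by simp [hv k hk hm]

namespace IsHyperbolicSystem

variable {n : ℕ} {e f : ℕ → V}

section
variable (hs : s.IsAlt) (hb : IsHyperbolicSystem s n e f)
include hs hb

theorem f_e {i j : ℕ} (hi : i < n) (hj : j < n) : s (f i) (e j) = if i = j then -1 else 0 := by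
  rw [hs.swap, hb.e_f j i hj hi]
  simp only [eq_comm (a := j)]
  split_ifs <;> simp

omit hs in
theorem e_f_self {i : ℕ} (hi : i < n) : s (e i) (f i) = 1 := by rw [hb.e_f i i hi hi, if_pos rfl]

omit hs in
theorem eq_of_form_eq {v w : V} (h : ∀ k < n, s v (e k) = s w (e k) ∧ s v (f k) = s w (f k)) :
    v = w :=
  sub_eq_zero.mp (hb.separating _ fun k hk => by simp [h k hk])

omit hs in
theorem ext_smul {g h : Sp s} (H : ∀ k < n, g • e k = h • e k ∧ g • f k = h • f k) : g = h := by
  rw [← inv_mul_eq_one]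
  refine Sp.ext_smul fun y => hb.eq_of_form_eq fun k hk => ?_
  have aux : ∀ x : V, g • x = h • x → s ((g⁻¹ * h) • y) x = s ((1 : Sp s) • y) x := fun x hx => by
    rw [one_smul, mul_smul, Sp.form_smul_left, inv_inv, hx, Sp.form_smul]
  exact ⟨aux _ (H k hk).1, aux _ (H k hk).2⟩

theorem eq_plane {j : ℕ} (hj : j < n) {v : V}
    (hv : ∀ k < n, k ≠ j → s v (e k) = 0 ∧ s v (f k) = 0) :
    v = s v (f j) • e j + (-s v (e j)) • f j := by
  refine hb.eq_of_form_eq fun k hk => ?_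
  by_cases hkj : k = j
  · subst hkj
    simp [hb.e_f, hb.e_e, hb.f_f, hb.f_e hs, hk]
  · simp [hb.e_f, hb.e_e, hb.f_f, hb.f_e hs, hk, hj, hv k hk hkj, Ne.symm hkj]

theorem eq_triple {i j : ℕ} (hi : i < n) (hj : j < n) (hij : i ≠ j) {v : V}
    (hv : ∀ k < n, (k ≠ j → s v (e k) = 0) ∧ (k ≠ i → k ≠ j → s v (f k) = 0)) :
    v = s v (f j) • e j + (-s v (e j)) • f j + s v (f i) • e i := by
  refine hb.eq_of_form_eq fun k hk => ?_
  by_cases hkj : k = j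
  · subst hkj
    simp [hb.e_f, hb.e_e, hb.f_f, hb.f_e hs, hk, hi, hij]
  · by_cases hki : k = i
    · subst hki
      simp [hb.e_f, hb.e_e, hb.f_f, hb.f_e hs, hk, hj, hij.symm, (hv k hk).1 hkj]
    · simp [hb.e_f, hb.e_e, hb.f_f, hb.f_e hs, hk, hj, hi, (hv k hk).1 hkj,
        (hv k hk).2 hki hkj, Ne.symm hkj, Ne.symm hki]

/-- All pairings of `g • v` with the system agree with those of `v`. For the index `j` this holds
because `g⁻¹` maps `e j` and `f j` into their own span, to which `v` is orthogonal. -/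
theorem fixesOffPlane_smul {j : ℕ} (hj : j < n) {g : Sp s} (hg : FixesOffPlane n e f j g) {v : V}
    (he : s v (e j) = 0) (hf : s v (f j) = 0) : g • v = v := by
  have hg' : FixesOffPlane n e f j g⁻¹ := fun k hk hkj => by
    rw [inv_smul_eq_iff, inv_smul_eq_iff, (hg k hk hkj).1, (hg k hk hkj).2]; exact ⟨rfl, rfl⟩
  refine hb.eq_of_form_eq fun k hk => ?_
  by_cases hkj : k = j
  · subst hkj
    have aux : ∀ x : V, (∀ l < n, l ≠ k → s x (e l) = 0 ∧ s x (f l) = 0) → s (g • v) x = 0 :=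
      fun x hx => by
      have hgx := hb.eq_plane hs hk (v := g⁻¹ • x) fun l hl hlk => by
        rw [Sp.form_smul_left, Sp.form_smul_left, inv_inv, (hg l hl hlk).1, (hg l hl hlk).2]
        exact hx l hl hlk
      rw [Sp.form_smul_left, hgx]
      simp [he, hf]
    rw [he, hf]
    constructor <;> refine aux _ fun l hl hlk => ?_
    · simp [hb.e_f, hb.e_e, hk, hl, hlk.symm]
    · simp [hb.f_e hs, hb.f_f, hk, hl, hlk.symm]
  · rw [Sp.form_smul_left, Sp.form_smul_left, (hg' k hk hkj).1, (hg' k hk hkj).2]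
    exact ⟨rfl, rfl⟩

theorem exists_plane {j : ℕ} (hj : j < n) {g : Sp s} (hg : FixesOffPlane n e f j g) {v : V}
    (hv : ∀ k < n, k ≠ j → s v (e k) = 0 ∧ s v (f k) = 0) :
    ∃ a b : F, g • v = a • e j + b • f j := by
  refine ⟨_, _, hb.eq_plane hs hj fun k hk hkj => ?_⟩
  have := hg k hk hkj
  constructor
  · rw [← this.1, Sp.form_smul]; exact (hv k hk hkj).1
  · rw [← this.2, Sp.form_smul]; exact (hv k hk hkj).2

theorem commute_of_fixesOffPlane {j : ℕ} (hj : j < n) {g h : Sp s} (hg : FixesOffPlane n e f j g)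
    (he : h • e j = e j) (hf : h • f j = f j) : Commute g h := by
  have hperp : ∀ x : V, s x (e j) = 0 → s x (f j) = 0 → g • h • x = h • g • x := fun x h1 h2 => by
    rw [hb.fixesOffPlane_smul hs hj hg h1 h2]
    refine hb.fixesOffPlane_smul hs hj hg ?_ ?_
    · rw [← he, Sp.form_smul, h1]
    · rw [← hf, Sp.form_smul, h2]
  refine hb.ext_smul fun k hk => ?_
  simp only [mul_smul]
  by_cases hkj : k = j
  · subst hkj
    obtain ⟨a, b, h1⟩ := hb.exists_plane hs hj hg (v := e k) fun l hl hlk => by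
      simp [hb.e_f, hb.e_e, hk, hl, hlk.symm]
    obtain ⟨c, d, h2⟩ := hb.exists_plane hs hj hg (v := f k) fun l hl hlk => by
      simp [hb.f_e hs, hb.f_f, hk, hl, hlk.symm]
    have hh : ∀ a b : F, h • (a • e k + b • f k) = a • e k + b • f k := fun a b => by
      rw [smul_add, smul_comm, he, smul_comm, hf]
    rw [he, hf, h1, h2, hh, hh]
    exact ⟨rfl, rfl⟩
  · exact ⟨hperp _ (by simp [hb.e_e, hk, hj]) (by simp [hb.e_f, hk, hj, hkj]),
      hperp _ (by simp [hb.f_e hs, hk, hj, hkj]) (by simp [hb.f_f, hk, hj])⟩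

omit hs hb in
theorem smul_sub_perp {g : Sp s} (hg : ∀ k < n, g • e k = e k) (v : V) {k : ℕ} (hk : k < n) :
    s (g • v - v) (e k) = 0 := by
  rw [map_sub, LinearMap.sub_apply, sub_eq_zero]
  conv_lhs => rw [← hg k hk]
  exact Sp.form_smul _ _ _

/-- Since `g` is an isometry, `g • v - v` is orthogonal to every vector fixed by `g`. -/
theorem fixesOffPair_smul_sub {i : ℕ} (hi : i + 1 < n) {g : Sp s} (hg : FixesOffPair n e f i g)
    (v : V) : ∃ a b : F, g • v - v = a • e i + b • e (i + 1) := by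
  have hp := fun k hk => smul_sub_perp (fun k hk => (hg k hk).1) v (k := k) hk
  have := hb.eq_triple hs (i := i) (j := i + 1) (by omega) hi (by omega) (v := g • v - v)
    fun k hk => ⟨fun _ => hp k hk, fun hki hki' => by
      rw [map_sub, LinearMap.sub_apply, sub_eq_zero]
      conv_lhs => rw [← (hg k hk).2 hki hki']
      exact Sp.form_smul _ _ _⟩
  rw [hp _ hi, neg_zero, zero_smul, add_zero] at this
  exact ⟨_, _, this.trans (add_comm _ _)⟩

theorem fixesOffPair_smul {i : ℕ} (hi : i + 1 < n) {g : Sp s} (hg : FixesOffPair n e f i g)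
    {v : V} (hv : ∀ k < n, s v (e k) = 0) : g • v = v := by
  have hg' : FixesOffPair n e f i g⁻¹ := fun k hk => by
    refine ⟨by rw [inv_smul_eq_iff, (hg k hk).1], fun h1 h2 => ?_⟩
    rw [inv_smul_eq_iff, (hg k hk).2 h1 h2]
  refine hb.eq_of_form_eq fun k hk => ⟨?_, ?_⟩
  · rw [Sp.form_smul_left, (hg' k hk).1]
  · rw [Sp.form_smul_left]
    by_cases h1 : k = i ∨ k = i + 1
    · obtain ⟨a, b, hab⟩ := hb.fixesOffPair_smul_sub hs hi hg' (f k)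
      rw [sub_eq_iff_eq_add.mp hab]
      simp [hv i (by omega), hv (i + 1) hi]
    · rw [(hg' k hk).2 (by omega) (by omega)]

/-- The image of `h - 1` is orthogonal to all `e k`, hence fixed by `g`. Therefore `(g - 1)(h - 1) =
0`, and likewise in the other order. -/
theorem commute_of_fixesOffPair {i j : ℕ} (hi : i + 1 < n) (hj : j + 1 < n) {g h : Sp s}
    (hg : FixesOffPair n e f i g) (hh : FixesOffPair n e f j h) : Commute g h := by
  refine hb.ext_smul fun k hk => ?_
  simp only [mul_smul]
  refine ⟨by rw [(hg k hk).1, (hh k hk).1, (hg k hk).1], ?_⟩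
  have h1 := hb.fixesOffPair_smul hs hi hg (v := h • f k - f k) fun l hl =>
    smul_sub_perp (fun k hk => (hh k hk).1) _ hl
  have h2 := hb.fixesOffPair_smul hs hj hh (v := g • f k - f k) fun l hl =>
    smul_sub_perp (fun k hk => (hg k hk).1) _ hl
  rw [smul_sub, sub_eq_iff_eq_add] at h1 h2
  rw [h1, h2]; abel

omit hs in
theorem e_mem_levelSpace {i m : ℕ} (hi : i < n) (him : i ≤ m) : e i ∈ levelSpace s n e f m :=
  fun k hk hm => by simp [hb.e_e, hb.e_f, hi, hk, show i ≠ k by omega]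

theorem f_mem_levelSpace {i m : ℕ} (hi : i < n) (him : i ≤ m) : f i ∈ levelSpace s n e f m :=
  fun k hk hm => by simp [hb.f_e hs, hb.f_f, hi, hk, show i ≠ k by omega]

theorem isNondegenerateOn_levelSpace (m : ℕ) : IsNondegenerateOn s (levelSpace s n e f m) := by
  intro u hu hu0
  by_contra! h
  refine hu0 (hb.separating u fun k hk => ?_)
  by_cases hm : m < k
  · exact hu k hk hm
  · exact ⟨h _ (hb.e_mem_levelSpace hk (by omega)), h _ (hb.f_mem_levelSpace hs hk (by omega))⟩

omit hb in
theorem fixesAbove_of_mem_fixOrthogonal {m : ℕ} {g : Sp s}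
    (hg : g ∈ fixOrthogonal s (levelSpace s n e f m)) : FixesAbove n e f m g := fun k hk hm =>
  ⟨hg _ fun y hy => by rw [hs.swap, (hy k hk hm).1, neg_zero],
    hg _ fun y hy => by rw [hs.swap, (hy k hk hm).2, neg_zero]⟩

omit hs hb in
theorem smul_mem_levelSpace {m : ℕ} {g : Sp s} (hg : FixesAbove n e f m g) {v : V}
    (hv : v ∈ levelSpace s n e f m) : g • v ∈ levelSpace s n e f m := fun k hk hm => by
  have := hg k hk hm
  constructor
  · rw [← this.1, Sp.form_smul]; exact (hv k hk hm).1
  · rw [← this.2, Sp.form_smul]; exact (hv k hk hm).2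

/-- The group acting on the plane `⟨e j, f j⟩` is transitive on its nonzero vectors. -/
theorem exists_fixesOffPlane_smul {j : ℕ} (hj : j < n) {a b : F} (hab : a ≠ 0 ∨ b ≠ 0) :
    ∃ g : Sp s, FixesOffPlane n e f j g ∧ g • e j = a • e j + b • f j := by
  set P := Submodule.span F {e j, f j} with hP
  have he : e j ∈ P := Submodule.subset_span (by simp)
  have hf : f j ∈ P := Submodule.subset_span (by simp)
  have hef := hb.e_f_self hj
  have hfe : s (f j) (e j) = -1 := by rw [hs.swap, hef]
  have hnd : IsNondegenerateOn s P := by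
    intro u hu hu0
    obtain ⟨c, d, rfl⟩ := Submodule.mem_span_pair.mp hu
    by_cases hc : c = 0
    · refine ⟨e j, he, ?_⟩
      have : d ≠ 0 := fun hd => hu0 (by simp [hc, hd])
      simpa [hs.self_eq_zero, hfe]
    · exact ⟨f j, hf, by simpa [hs.self_eq_zero, hef]⟩
  have he0 : e j ≠ 0 := fun h => by simp [h] at hef
  have hv0 : a • e j + b • f j ≠ 0 := fun h => by
    have h1 : s (a • e j + b • f j) (f j) = 0 := by rw [h]; simp
    have h2 : s (e j) (a • e j + b • f j) = 0 := by rw [h]; simp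
    simp only [map_add, map_smul, LinearMap.add_apply, LinearMap.smul_apply, hef,
      hs.self_eq_zero, smul_eq_mul, mul_zero, mul_one, zero_add, add_zero] at h1 h2
    exact hab.elim (· h1) (· h2)
  obtain ⟨g, hg, hge⟩ := exists_fixOrthogonal_smul hs hnd he
    (add_mem (P.smul_mem a he) (P.smul_mem b hf)) he0 hv0
  refine ⟨g, fun k hk hkj => ?_, hge⟩
  have aux : ∀ x : V, s x (e j) = 0 → s x (f j) = 0 → g • x = x := fun x h1 h2 => hg x fun y hy => by
    obtain ⟨c, d, rfl⟩ := Submodule.mem_span_pair.mp hy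
    simp [h1, h2]
  exact ⟨aux _ (by simp [hb.e_e, hk, hj]) (by simp [hb.e_f, hk, hj, hkj]),
      aux _ (by simp [hb.f_e hs, hk, hj, hkj]) (by simp [hb.f_f, hk, hj])⟩

theorem fixesOffPair_of_isHeisenberg {i : ℕ} (hi : i + 1 < n) {b : F} {g : Sp s}
    (hg : IsHeisenberg (e (i + 1)) (b • e i) g) : FixesOffPair n e f i g := fun k hk =>
  ⟨by rw [hg]; simp [hb.e_e, hk, hi, show i < n by omega], fun h1 h2 => by
    rw [hg]; simp [hb.f_e hs, hk, hi, show i < n by omega, h1, h2]⟩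

theorem fixesOffPair_of_isTransvection {i : ℕ} (hi : i + 1 < n) {b : F} {g : Sp s}
    (hg : IsTransvection (e (i + 1)) b g) : FixesOffPair n e f i g := fun k hk =>
  ⟨by rw [hg]; simp [hb.e_e, hk, hi], fun h1 h2 => by rw [hg]; simp [hb.f_e hs, hk, hi, h2]⟩

theorem fixesOffPlane_of_isTransvection {i : ℕ} (hi : i < n) {b : F} {g : Sp s}
    (hg : IsTransvection (e i) b g) : FixesOffPlane n e f i g := fun k hk hki =>
  ⟨by rw [hg]; simp [hb.e_e, hk, hi], by rw [hg]; simp [hb.f_e hs, hk, hi, hki]⟩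

end

end IsHyperbolicSystem

end HyperbolicSystem

/-! ### Lifts of the slim amalgam, their commutation relations, and the lifted Heisenberg maps. -/

section SlimLift

variable {F V : Type*} [Field F] [AddCommGroup V] [Module F V] {s : LinearMap.BilinForm F V}
  {K : Type*} [Group K] {φ : K →* Sp s} {n : ℕ} {e f : ℕ → V} {M S : ℕ → Subgroup K}

/-- The homomorphism `φ` has trivial kernel on the subgroup `L`. -/
def InjectiveOn {G : Type*} [Group G] (φ : K →* G) (L : Subgroup K) : Prop :=
  ∀ x ∈ L, φ x = 1 → x = 1

theorem InjectiveOn.eq {G : Type*} [Group G] {φ : K →* G} {L : Subgroup K} (h : InjectiveOn φ L)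
    {x y : K} (hx : x ∈ L) (hy : y ∈ L) (hxy : φ x = φ y) : x = y :=
  inv_mul_eq_one.mp (h _ (mul_mem (inv_mem hx) hy) (by simp [hxy]))

theorem InjectiveOn.commute {G : Type*} [Group G] {φ : K →* G} {L : Subgroup K}
    (h : InjectiveOn φ L) {x y : K} (hx : x ∈ L) (hy : y ∈ L) (hxy : Commute (φ x) (φ y)) :
    Commute x y :=
  h.eq (mul_mem hx hy) (mul_mem hy hx) (by rw [map_mul, map_mul, hxy.eq])

/-- Subgroups of `K` that lift the groups of the slim amalgam, injectively on the pairwise joins. -/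
structure IsSlimLift (φ : K →* Sp s) (n : ℕ) (e f : ℕ → V) (M S : ℕ → Subgroup K) : Prop where
  exists_S : ∀ j < n, ∀ g, FixesOffPlane n e f j g → ∃ x ∈ S j, φ x = g
  fixes_S : ∀ j < n, ∀ x ∈ S j, FixesOffPlane n e f j (φ x)
  exists_M : ∀ i, i + 1 < n → ∀ g, FixesOffPair n e f i g → ∃ x ∈ M i, φ x = g
  fixes_M : ∀ i, i + 1 < n → ∀ x ∈ M i, FixesOffPair n e f i (φ x)
  inj_SS : ∀ i < n, ∀ j < n, InjectiveOn φ (S i ⊔ S j)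
  inj_MM : ∀ i j, i + 1 < n → j + 1 < n → InjectiveOn φ (M i ⊔ M j)
  inj_MS : ∀ i, i + 1 < n → ∀ j < n, InjectiveOn φ (M i ⊔ S j)

/-- The subgroup generated by the lifted groups with indices up to `m`. -/
def liftedLevel (M S : ℕ → Subgroup K) : ℕ → Subgroup K
  | 0 => S 0
  | m + 1 => liftedLevel M S m ⊔ M m ⊔ S (m + 1)

theorem liftedLevel_le {L : Subgroup K} {m : ℕ} (hS : ∀ j ≤ m, S j ≤ L) (hM : ∀ i < m, M i ≤ L) :
    liftedLevel M S m ≤ L := by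
  induction m with
  | zero => exact hS 0 le_rfl
  | succ m ih =>
    exact sup_le (sup_le (ih (fun j hj => hS j (by omega)) fun i hi => hM i (by omega))
      (hM m (by omega))) (hS _ le_rfl)

theorem S_le_liftedLevel (m : ℕ) : S m ≤ liftedLevel M S m := by
  cases m with
  | zero => exact le_rfl
  | succ m => exact le_sup_right

theorem commute_of_mem_liftedLevel {m : ℕ} {y : K} (hS : ∀ j ≤ m, ∀ x ∈ S j, Commute x y)
    (hM : ∀ i < m, ∀ x ∈ M i, Commute x y) {x : K} (hx : x ∈ liftedLevel M S m) : Commute x y := by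
  have : liftedLevel M S m ≤ Subgroup.centralizer {y} := liftedLevel_le
    (fun j hj x hx => Subgroup.mem_centralizer_singleton_iff.mpr (hS j hj x hx).eq)
    (fun i hi x hx => Subgroup.mem_centralizer_singleton_iff.mpr (hM i hi x hx).eq)
  exact Subgroup.mem_centralizer_singleton_iff.mp (this hx)

/-- The induction hypothesis on the subgroup with indices up to `m`. -/
structure IsFaithfulLevel (φ : K →* Sp s) (n : ℕ) (e f : ℕ → V) (M S : ℕ → Subgroup K) (m : ℕ) :
    Prop where
  inj : InjectiveOn φ (liftedLevel M S m)
  surj : ∀ g, FixesAbove n e f m g → ∃ x ∈ liftedLevel M S m, φ x = g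
  comm : m + 1 < n → ∀ x ∈ liftedLevel M S m, φ x • e m = e m → ∀ y ∈ M m, Commute x y

/-- Lifts of the elements of the Heisenberg group of `e (m + 1)`. -/
structure IsHeisenbergLift (φ : K →* Sp s) (n : ℕ) (e f : ℕ → V) (M S : ℕ → Subgroup K) (m : ℕ)
    (q : V → K) (t : F → K) : Prop where
  heisenberg : ∀ v ∈ levelSpace s n e f m, IsHeisenberg (e (m + 1)) v (φ (q v))
  conj : ∀ x ∈ liftedLevel M S m, ∀ v ∈ levelSpace s n e f m, x * q v * x⁻¹ = q (φ x • v)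
  mem : ∀ v, q v ∈ liftedLevel M S m ⊔ M m
  mem_line : ∀ b : F, q (b • e m) ∈ M m
  mem_plane : ∀ a b : F, q (a • e m + b • f m) ∈ M m ⊔ S m
  t_mem : ∀ a, t a ∈ M m
  transvection : ∀ a, IsTransvection (e (m + 1)) a (φ (t a))

namespace IsSlimLift

variable (hs : s.IsAlt) (hb : IsHyperbolicSystem s n e f) (hl : IsSlimLift φ n e f M S)
include hs hb hl

omit hs hb in
theorem fixesAbove {m : ℕ} {x : K} (hx : x ∈ liftedLevel M S m) :
    FixesAbove n e f m (φ x) := fun k hk hmk => by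
  have : liftedLevel M S m ≤ ((MulAction.stabilizer (Sp s) (e k)) ⊓
      (MulAction.stabilizer (Sp s) (f k))).comap φ := liftedLevel_le
    (fun j hj x hx => hl.fixes_S j (by omega) x hx k hk (by omega))
    (fun i hi x hx => ⟨(hl.fixes_M i (by omega) x hx k hk).1,
      (hl.fixes_M i (by omega) x hx k hk).2 (by omega) (by omega)⟩)
  exact this hx

theorem commute_S {m j : ℕ} (hmj : m < j) (hj : j < n) {x y : K} (hx : x ∈ liftedLevel M S m)
    (hy : y ∈ S j) : Commute x y := by
  refine commute_of_mem_liftedLevel (fun i hi x hx => ?_) (fun i hi x hx => ?_) hx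
  · have := hl.fixes_S i (by omega) x hx j hj (by omega)
    exact (hl.inj_SS i (by omega) j hj).commute (Subgroup.mem_sup_left hx)
      (Subgroup.mem_sup_right hy)
      (hb.commute_of_fixesOffPlane hs hj (hl.fixes_S j hj y hy) this.1 this.2).symm
  · have := hl.fixes_M i (by omega) x hx j hj
    exact (hl.inj_MS i (by omega) j hj).commute (Subgroup.mem_sup_left hx)
      (Subgroup.mem_sup_right hy) (hb.commute_of_fixesOffPlane hs hj (hl.fixes_S j hj y hy) this.1
        (this.2 (by omega) (by omega))).symm

theorem commute_M_M {i j : ℕ} (hi : i + 1 < n) (hj : j + 1 < n) {x y : K} (hx : x ∈ M i)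
    (hy : y ∈ M j) : Commute x y :=
  (hl.inj_MM i j hi hj).commute (Subgroup.mem_sup_left hx) (Subgroup.mem_sup_right hy)
    (hb.commute_of_fixesOffPair hs hi hj (hl.fixes_M i hi x hx) (hl.fixes_M j hj y hy))

theorem commute_M {m i : ℕ} (hmi : m < i) (hi : i + 1 < n) {x y : K} (hx : x ∈ liftedLevel M S m)
    (hy : y ∈ M i) : Commute x y := by
  refine commute_of_mem_liftedLevel (fun j hj x hx => ?_)
    (fun j hj x hx => hl.commute_M_M hs hb (by omega) hi hx hy) hx
  have := hl.fixes_M i hi y hy j (by omega)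
  exact (hl.inj_MS i hi j (by omega)).commute (Subgroup.mem_sup_right hx)
    (Subgroup.mem_sup_left hy) (hb.commute_of_fixesOffPlane hs (by omega)
      (hl.fixes_S j (by omega) x hx) this.1 (this.2 (by omega) (by omega)))

/-- A transvection along `e (m + 1)` commutes with everything fixing that vector. The amalgam
supplies this commutation in `K` for each generator of level `m` separately. -/
theorem commute_transvection {m : ℕ} (hm : m + 1 < n) {x y : K} (hx : x ∈ liftedLevel M S m)
    (hy : y ∈ M m) {a : F} (ha : IsTransvection (e (m + 1)) a (φ y)) : Commute x y := by
  refine commute_of_mem_liftedLevel (fun j hj x hx => ?_)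
    (fun j hj x hx => hl.commute_M_M hs hb (by omega) hm hx hy) hx
  exact (hl.inj_MS m hm j (by omega)).commute (Subgroup.mem_sup_right hx)
    (Subgroup.mem_sup_left hy) (ha.commute (hl.fixes_S j (by omega) x hx _ hm (by omega)).1)

theorem isFaithfulLevel_zero (hn : 0 < n) : IsFaithfulLevel φ n e f M S 0 where
  inj x hx hx1 := hl.inj_SS 0 hn 0 hn x (Subgroup.mem_sup_left hx) hx1
  surj g hg := hl.exists_S 0 hn g fun k hk hk0 => hg k hk (by omega)
  comm hm x hx hxe y hy := by
    refine (hl.inj_MS 0 hm 0 hn).commute (Subgroup.mem_sup_right hx) (Subgroup.mem_sup_left hy)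
      -- An element of the plane group that fixes `e 0` acts as an element of the abelian group of
      -- the pair `0, 1`.
      (hb.commute_of_fixesOffPair hs hm hm (fun k hk => ?_) (hl.fixes_M 0 hm y hy))
    by_cases hk0 : k = 0
    · subst hk0
      exact ⟨hxe, fun h => absurd rfl h⟩
    · exact ⟨(hl.fixes_S 0 hn x hx k hk hk0).1, fun _ _ => (hl.fixes_S 0 hn x hx k hk hk0).2⟩

variable {m : ℕ} (hm : m + 1 < n)
include hm

theorem exists_M_transvection (a : F) : ∃ y ∈ M m, IsTransvection (e (m + 1)) a (φ y) := by
  obtain ⟨g, hg⟩ := Sp.exists_transvection hs (e (m + 1)) a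
  obtain ⟨y, hy, rfl⟩ := hl.exists_M m hm g (hb.fixesOffPair_of_isTransvection hs hm hg)
  exact ⟨y, hy, hg⟩

theorem exists_M_heisenberg (b : F) : ∃ y ∈ M m, IsHeisenberg (e (m + 1)) (b • e m) (φ y) := by
  obtain ⟨g, hg⟩ := Sp.exists_heisenberg hs (e := e (m + 1)) (v := b • e m)
    (by rw [map_smul, hb.e_e _ _ hm (by omega), smul_zero])
  obtain ⟨y, hy, rfl⟩ := hl.exists_M m hm g (hb.fixesOffPair_of_isHeisenberg hs hm hg)
  exact ⟨y, hy, hg⟩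

/-- For `v ≠ 0`, `q v` is the conjugate of the lift for `e m` by an element of level `m` that takes
`e m` to `v`. It does not depend on the conjugating element because the stabilizer of `e m` in level
`m` centralizes `M m`, which is the clause `comm` of the induction hypothesis. -/
theorem exists_heisenberg_lift (ih : IsFaithfulLevel φ n e f M S m) :
    ∃ (q : V → K) (t : F → K), IsHeisenbergLift φ n e f M S m q t := by
  classical
  have hmn : m < n := by omega
  have hem0 : e m ≠ 0 := fun h => by simpa [h] using hb.e_f_self hmn
  have hem := hb.e_mem_levelSpace hmn (le_refl m)
  have htrans : ∀ v : V, ∃ x ∈ liftedLevel M S m,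
      v ∈ levelSpace s n e f m → v ≠ 0 → φ x • e m = v := by
    intro v
    by_cases h : v ∈ levelSpace s n e f m ∧ v ≠ 0
    · obtain ⟨g, hg, hgv⟩ := exists_fixOrthogonal_smul hs (hb.isNondegenerateOn_levelSpace hs m)
        hem h.1 hem0 h.2
      obtain ⟨x, hx, rfl⟩ := ih.surj g (IsHyperbolicSystem.fixesAbove_of_mem_fixOrthogonal hs hg)
      exact ⟨x, hx, fun _ _ => hgv⟩
    · exact ⟨1, one_mem _, fun h1 h2 => absurd ⟨h1, h2⟩ h⟩
  choose g hg hgv using htrans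
  obtain ⟨x₁, hx₁, hx₁h⟩ := hl.exists_M_heisenberg hs hb hm (1 : F)
  rw [one_smul] at hx₁h
  let q : V → K := fun v => if v = 0 then 1 else g v * x₁ * (g v)⁻¹
  have hq0 : q 0 = 1 := if_pos rfl
  have key : ∀ x ∈ liftedLevel M S m, q (φ x • e m) = x * x₁ * x⁻¹ := by
    intro x hx
    have hne : φ x • e m ≠ 0 := fun h => hem0 ((smul_eq_zero_iff_eq _).mp h)
    have hmem := IsHyperbolicSystem.smul_mem_levelSpace (hl.fixesAbove hx) hem
    have hc := ih.comm hm ((g (φ x • e m))⁻¹ * x) (mul_mem (inv_mem (hg _)) hx) (by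
      rw [map_mul, map_inv, mul_smul, inv_smul_eq_iff, hgv _ hmem hne]) x₁ hx₁
    have hqx : q (φ x • e m) = g (φ x • e m) * x₁ * (g (φ x • e m))⁻¹ := if_neg hne
    rw [hqx]
    generalize g (φ x • e m) = y at hc
    calc y * x₁ * y⁻¹ = y * (x₁ * (y⁻¹ * x)) * x⁻¹ := by group
      _ = y * (y⁻¹ * x * x₁) * x⁻¹ := by rw [hc.eq]
      _ = _ := by group
  have hreach : ∀ v ∈ levelSpace s n e f m, v ≠ 0 → q v = g v * x₁ * (g v)⁻¹ :=
    fun v _ h0 => if_neg h0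
  -- For vectors of the plane the conjugating element can be chosen in `S m`, so that `q` takes
  -- values in `M m ⊔ S m`, where `φ` is injective.
  have hplane : ∀ a b : F, (a ≠ 0 ∨ b ≠ 0) → ∃ x ∈ S m, φ x • e m = a • e m + b • f m := by
    intro a b hab
    obtain ⟨g, hg, hge⟩ := hb.exists_fixesOffPlane_smul hs hmn hab
    obtain ⟨x, hx, rfl⟩ := hl.exists_S m hmn g hg
    exact ⟨x, hx, hge⟩
  have hheis : ∀ v ∈ levelSpace s n e f m, IsHeisenberg (e (m + 1)) v (φ (q v)) := by
    intro v hv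
    by_cases h0 : v = 0
    · rw [h0, hq0, map_one]
      exact fun y => by simp
    · rw [hreach v hv h0, map_mul, map_mul, map_inv]
      conv in IsHeisenberg _ _ => rw [← hgv v hv h0]
      exact hx₁h.conj (hl.fixesAbove (hg v) (m + 1) hm (by omega)).1
  choose t ht htt using hl.exists_M_transvection hs hb hm
  refine ⟨q, t, hheis, ?_, ?_, ?_, ?_, ht, htt⟩
  · intro x hx v hv
    by_cases h0 : v = 0
    · rw [h0, smul_zero, hq0]; simp
    · rw [hreach v hv h0]
      conv_rhs => rw [← hgv v hv h0, smul_smul, ← map_mul, key _ (mul_mem hx (hg v))]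
      group
  · intro v
    by_cases h0 : v = 0
    · rw [h0, hq0]; exact one_mem _
    · have : q v = g v * x₁ * (g v)⁻¹ := if_neg h0
      rw [this]
      exact mul_mem (mul_mem (Subgroup.mem_sup_left (hg v)) (Subgroup.mem_sup_right hx₁))
        (inv_mem (Subgroup.mem_sup_left (hg v)))
  · intro b
    by_cases h0 : b = 0
    · rw [h0, zero_smul, hq0]; exact one_mem _
    · obtain ⟨x, hx, hxe⟩ := hplane b 0 (.inl h0)
      rw [zero_smul, add_zero] at hxe
      obtain ⟨y, hy, hyh⟩ := hl.exists_M_heisenberg hs hb hm b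
      have hqx := key x (S_le_liftedLevel m hx)
      rw [hxe] at hqx
      have : q (b • e m) = y := (hl.inj_MS m hm m hmn).eq
        (by rw [hqx]; exact mul_mem (mul_mem (Subgroup.mem_sup_right hx)
              (Subgroup.mem_sup_left hx₁)) (inv_mem (Subgroup.mem_sup_right hx)))
        (Subgroup.mem_sup_left hy)
        ((hheis _ (Submodule.smul_mem _ _ hem)).unique hyh)
      rwa [this]
  · intro a b
    by_cases hab : a ≠ 0 ∨ b ≠ 0
    · obtain ⟨x, hx, hxe⟩ := hplane a b hab
      rw [← hxe, key x (S_le_liftedLevel m hx)]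
      exact mul_mem (mul_mem (Subgroup.mem_sup_right hx) (Subgroup.mem_sup_left hx₁))
        (inv_mem (Subgroup.mem_sup_right hx))
    · push Not at hab
      rw [hab.1, hab.2, zero_smul, zero_smul, add_zero, hq0]
      exact one_mem _

end IsSlimLift

end SlimLift

/-! ### Multiplication of the lifted Heisenberg maps and the induction on the level. -/

section SlimInduction

variable {F V : Type*} [Field F] [AddCommGroup V] [Module F V] {s : LinearMap.BilinForm F V}
  {K : Type*} [Group K] {φ : K →* Sp s} {n : ℕ} {e f : ℕ → V} {M S : ℕ → Subgroup K}

/-- In a field with more than two elements, three vectors `u, v, u + v` have a common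
non-orthogonal vector. -/
theorem exists_common_ne_zero_add (hF : ∀ a b : F, ∃ c, c ≠ a ∧ c ≠ b) {Y : Submodule F V}
    (hY : IsNondegenerateOn s Y) {u v : V} (hu : u ∈ Y) (hv : v ∈ Y) (hu0 : u ≠ 0) (hv0 : v ≠ 0)
    (huv : u + v ≠ 0) : ∃ w ∈ Y, s u w ≠ 0 ∧ s v w ≠ 0 ∧ s (u + v) w ≠ 0 := by
  obtain ⟨x, hx, hux, hvx⟩ := exists_common_ne_zero (hY u hu hu0) (hY v hv hv0)
  by_cases hxx : s (u + v) x = 0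
  swap
  · exact ⟨x, hx, hux, hvx, hxx⟩
  obtain ⟨y, hy, hyy⟩ := hY _ (add_mem hu hv) huv
  -- As `x` is orthogonal to `u + v`, adding `c • x` to `y` does not affect the pairing with `u +
  -- v`. Each of `u` and `v` excludes one value of `c`.
  obtain ⟨c, hc₁, hc₂⟩ := hF (-(s u y / s u x)) (-(s v y / s v x))
  refine ⟨y + c • x, add_mem hy (Y.smul_mem c hx), ?_, ?_, ?_⟩
  · rw [map_add, map_smul, smul_eq_mul]
    intro h
    exact hc₁ (by field_simp; linear_combination h)
  · rw [map_add, map_smul, smul_eq_mul]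
    intro h
    exact hc₂ (by field_simp; linear_combination h)
  · rw [map_add, map_smul, hxx, smul_zero, add_zero]
    exact hyy

namespace IsHeisenbergLift

variable {m : ℕ} {q : V → K} {t : F → K} (hs : s.IsAlt) (hb : IsHyperbolicSystem s n e f)
  (hl : IsSlimLift φ n e f M S) (hm : m + 1 < n) (hq : IsHeisenbergLift φ n e f M S m q t)
include hs hb hl hm hq

theorem commute_t {x : K} (hx : x ∈ liftedLevel M S m ⊔ M m) (a : F) : Commute x (t a) := by
  have : liftedLevel M S m ⊔ M m ≤ Subgroup.centralizer {t a} := sup_le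
    (fun x hx => Subgroup.mem_centralizer_singleton_iff.mpr
      (hl.commute_transvection hs hb hm hx (hq.t_mem a) (hq.transvection a)).eq)
    (fun x hx => Subgroup.mem_centralizer_singleton_iff.mpr
      (hl.commute_M_M hs hb hm hm hx (hq.t_mem a)).eq)
  exact Subgroup.mem_centralizer_singleton_iff.mp (this hx)

omit hb in
theorem t_mul (a b : F) : t a * t b = t (a + b) :=
  (hl.inj_MM m m hm hm).eq (Subgroup.mem_sup_left (mul_mem (hq.t_mem a) (hq.t_mem b)))
    (Subgroup.mem_sup_left (hq.t_mem _)) (by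
      rw [map_mul]; exact ((hq.transvection a).mul hs (hq.transvection b)).unique
        (hq.transvection _))

omit hs hb in
theorem t_zero : t 0 = 1 :=
  hl.inj_MM m m hm hm _ (Subgroup.mem_sup_left (hq.t_mem 0))
    (Sp.ext_smul fun y => by rw [hq.transvection, one_smul]; simp)

omit hs hb in
theorem q_zero : q 0 = 1 := by
  refine hl.inj_MM m m hm hm _ (Subgroup.mem_sup_left ?_)
    (Sp.ext_smul fun y => by rw [hq.heisenberg 0 (zero_mem _), one_smul]; simp)
  simpa using hq.mem_line 0

omit hb hl hq in
theorem e_succ_perp {v : V} (hv : v ∈ levelSpace s n e f m) : s (e (m + 1)) v = 0 := by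
  rw [hs.swap, (hv _ hm (by omega)).1, neg_zero]

omit hb hl in
theorem map_q_mul {u v : V} (hu : u ∈ levelSpace s n e f m) (hv : v ∈ levelSpace s n e f m) :
    φ (q u * q v) = φ (q (u + v) * t (s v u)) := by
  rw [map_mul, map_mul]
  exact (hq.heisenberg u hu).mul hs (hq.heisenberg v hv) (hq.heisenberg _ (add_mem hu hv))
    (hq.transvection _) (e_succ_perp hs hm hu) (e_succ_perp hs hm hv)

theorem q_mul_plane (a b a' b' : F) :
    q (a • e m + b • f m) * q (a' • e m + b' • f m) =
      q ((a • e m + b • f m) + (a' • e m + b' • f m)) *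
        t (s (a' • e m + b' • f m) (a • e m + b • f m)) := by
  have hmem : ∀ a b : F, a • e m + b • f m ∈ levelSpace s n e f m := fun a b =>
    add_mem (Submodule.smul_mem _ _ (hb.e_mem_levelSpace (by omega) le_rfl))
      (Submodule.smul_mem _ _ (hb.f_mem_levelSpace hs (by omega) le_rfl))
  refine (hl.inj_MS m hm m (by omega)).eq (mul_mem (hq.mem_plane _ _) (hq.mem_plane _ _))
    (mul_mem ?_ (Subgroup.mem_sup_left (hq.t_mem _))) (hq.map_q_mul hs hm (hmem _ _) (hmem _ _))
  rw [show a • e m + b • f m + (a' • e m + b' • f m) = (a + a') • e m + (b + b') • f m by module]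
  exact hq.mem_plane _ _

/-- Level `m` carries the pair `e m, a • f m` with `a = s u v` to `u, v`. Conjugation transports the
product formula from the plane, and `t` is unaffected because it commutes with level `m`. -/
theorem q_mul_of_ne (ih : IsFaithfulLevel φ n e f M S m) {u v : V} (hu : u ∈ levelSpace s n e f m)
    (hv : v ∈ levelSpace s n e f m) (huv : s u v ≠ 0) : q u * q v = q (u + v) * t (s v u) := by
  have hmn : m < n := by omega
  have hef := hb.e_f_self hmn
  have hem := hb.e_mem_levelSpace hmn (le_refl m)
  have hfm := hb.f_mem_levelSpace hs hmn (le_refl m)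
  obtain ⟨g₁, hg₁, hgu⟩ := exists_fixOrthogonal_smul hs (hb.isNondegenerateOn_levelSpace hs m)
    hem hu (fun h => by simp [h] at hef) (fun h => by simp [h] at huv)
  have hg₁f := IsHyperbolicSystem.fixesAbove_of_mem_fixOrthogonal hs hg₁
  obtain ⟨a, ha⟩ : ∃ a, a = s u v := ⟨_, rfl⟩
  have hafm := Submodule.smul_mem _ a hfm
  have h1 : s u (g₁ • (a • f m)) = s u v := by
    rw [← ha, ← hgu, Sp.form_smul, map_smul, hef, smul_eq_mul, mul_one]
  obtain ⟨g₂, hg₂, hgu', hgv⟩ := exists_fixOrthogonal_smul_fix hs hu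
    (IsHyperbolicSystem.smul_mem_levelSpace hg₁f hafm) hv (by rwa [h1]) h1
  obtain ⟨x, hx, hxg⟩ := ih.surj (g₂ * g₁)
    (IsHyperbolicSystem.fixesAbove_of_mem_fixOrthogonal hs (mul_mem hg₂ hg₁))
  have hxu : φ x • e m = u := by rw [hxg, mul_smul, hgu, hgu']
  have hxv : φ x • (a • f m) = v := by rw [hxg, mul_smul, hgv]
  have hpl := hq.q_mul_plane hs hb hl hm 1 0 0 a
  have hc := hq.commute_t hs hb hl hm (Subgroup.mem_sup_left hx) (s v u)
  have hsvu : s (a • f m) (e m) = s v u := by rw [← hxu, ← hxv, Sp.form_smul]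
  simp only [one_smul, zero_smul, add_zero, zero_add, hsvu] at hpl
  have hqu := hq.conj x hx _ hem
  have hqv := hq.conj x hx _ hafm
  have hquv := hq.conj x hx _ (add_mem hem hafm)
  rw [smul_add, hxu, hxv] at hquv
  rw [hxu] at hqu
  rw [hxv] at hqv
  rw [← hqu, ← hqv, ← hquv]
  calc x * q (e m) * x⁻¹ * (x * q (a • f m) * x⁻¹)
      = x * (q (e m) * q (a • f m)) * x⁻¹ := by group
    _ = x * q (e m + a • f m) * (t (s v u) * x⁻¹) := by rw [hpl]; group
    _ = _ := by rw [← hc.inv_left.eq, ← mul_assoc]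

/-- Orthogonal arguments are the difficulty. If `u + v = 0`, the pair is conjugate to `e m, -e m`.
Otherwise `u` is written as `u₁ + u₂` so that the pairs `(u₁, u₂)`, `(u₂, v)` and `(u₁, u₂ + v)` are
all non-orthogonal, and associativity gives the formula. -/
theorem q_mul (hF : ∀ a b : F, ∃ c, c ≠ a ∧ c ≠ b) (ih : IsFaithfulLevel φ n e f M S m) {u v : V}
    (hu : u ∈ levelSpace s n e f m) (hv : v ∈ levelSpace s n e f m) :
    q u * q v = q (u + v) * t (s v u) := by
  by_cases hu0 : u = 0
  · simp [hu0, hq.q_zero hl hm, hq.t_zero hl hm]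
  by_cases hv0 : v = 0
  · simp [hv0, hq.q_zero hl hm, hq.t_zero hl hm]
  by_cases huv : s u v ≠ 0
  · exact hq.q_mul_of_ne hs hb hl hm ih hu hv huv
  rw [not_not] at huv
  have hvu : s v u = 0 := by rw [hs.swap, huv, neg_zero]
  have hmn : m < n := by omega
  have hem := hb.e_mem_levelSpace (f := f) (e := e) (s := s) hmn (le_refl m)
  by_cases huv0 : u + v = 0
  · have hef := hb.e_f_self hmn
    obtain ⟨g, hg, hgu⟩ := exists_fixOrthogonal_smul hs (hb.isNondegenerateOn_levelSpace hs m)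
      hem hu (fun h => by simp [h] at hef) hu0
    obtain ⟨x, hx, rfl⟩ := ih.surj g (IsHyperbolicSystem.fixesAbove_of_mem_fixOrthogonal hs hg)
    have hpl := hq.q_mul_plane hs hb hl hm 1 0 (-1) 0
    simp only [one_smul, zero_smul, add_zero, neg_smul, add_neg_cancel, map_neg,
      LinearMap.neg_apply, hs.self_eq_zero, neg_zero] at hpl
    have hv' : φ x • (-e m) = v := by
      rw [smul_neg, hgu]; exact neg_eq_of_add_eq_zero_right huv0
    rw [huv0, hvu, ← hgu, ← hv', ← hq.conj x hx _ hem, ← hq.conj x hx _ (neg_mem hem), ← hpl]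
    calc x * q (e m) * x⁻¹ * (x * q (-e m) * x⁻¹) = x * (q (e m) * q (-e m)) * x⁻¹ := by group
      _ = _ := by rw [hpl, hq.q_zero hl hm, hq.t_zero hl hm]; simp
  -- The three pairs are non-orthogonal exactly when `u₁` is orthogonal to none of `u`, `v` and `u +
  -- v`, given `s u v = 0`.
  obtain ⟨u₁, hu₁, h1, h2, h3⟩ :=
    exists_common_ne_zero_add hF (hb.isNondegenerateOn_levelSpace hs m) hu hv hu0 hv0 huv0
  obtain ⟨u₂, rfl⟩ : ∃ u₂, u = u₁ + u₂ := ⟨u - u₁, by abel⟩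
  have hu₂ : u₂ ∈ levelSpace s n e f m := by simpa using sub_mem hu hu₁
  have hsplit : q (u₁ + u₂) = q u₁ * q u₂ * t (-s u₂ u₁) := by
    have hne : s u₁ u₂ ≠ 0 := by
      rw [hs.swap]; simpa [hs.self_eq_zero] using h1
    rw [hq.q_mul_of_ne hs hb hl hm ih hu₁ hu₂ hne, mul_assoc, hq.t_mul hs hl hm, add_neg_cancel,
      hq.t_zero hl hm, mul_one]
  have e1 : q u₂ * q v = q (u₂ + v) * t (s v u₂) := by
    refine hq.q_mul_of_ne hs hb hl hm ih hu₂ hv fun h => h2 ?_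
    rw [map_add, LinearMap.add_apply, h, add_zero] at huv
    rw [hs.swap, huv, neg_zero]
  have e2 : q u₁ * q (u₂ + v) = q (u₁ + (u₂ + v)) * t (s (u₂ + v) u₁) := by
    refine hq.q_mul_of_ne hs hb hl hm ih hu₁ (add_mem hu₂ hv) ?_
    rw [hs.swap, neg_ne_zero]
    simpa [hs.self_eq_zero] using h3
  have hc := hq.commute_t hs hb hl hm (hq.mem v) (-s u₂ u₁)
  calc q (u₁ + u₂) * q v = q u₁ * q u₂ * (t (-s u₂ u₁) * q v) := by rw [hsplit, mul_assoc]
    _ = q u₁ * (q u₂ * q v) * t (-s u₂ u₁) := by rw [← hc.eq]; group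
    _ = q u₁ * q (u₂ + v) * (t (s v u₂) * t (-s u₂ u₁)) := by rw [e1]; group
    _ = q (u₁ + (u₂ + v)) * (t (s (u₂ + v) u₁) * (t (s v u₂) * t (-s u₂ u₁))) := by
      rw [e2]; group
    _ = q (u₁ + u₂ + v) * t (s v (u₁ + u₂)) := by
      rw [hq.t_mul hs hl hm, hq.t_mul hs hl hm, ← add_assoc u₁]
      congr 2
      simp only [map_add, LinearMap.add_apply]
      ring

omit hl in
theorem smul_f {v : V} (hv : v ∈ levelSpace s n e f m) (c : F) :
    φ (q v * t c) • f (m + 1) = f (m + 1) - v - c • e (m + 1) := by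
  have h1 := hv _ hm (by omega)
  have h2 : s (f (m + 1)) v = 0 := by rw [hs.swap, h1.2, neg_zero]
  have h3 : s (e (m + 1)) v = 0 := by rw [hs.swap, h1.1, neg_zero]
  have h4 : s (f (m + 1)) (e (m + 1)) = -1 := by rw [hb.f_e hs hm hm, if_pos rfl]
  rw [map_mul, mul_smul, hq.transvection, hq.heisenberg v hv]
  simp only [map_add, map_smul, LinearMap.add_apply, LinearMap.smul_apply, h2, h3, h4,
    hs.self_eq_zero, smul_eq_mul]
  module

/-- The parameters `b` and `c` are read off from the action on `f (m + 1)`. The quotient then fixes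
everything off the plane of index `m`, and injectivity on `M m ⊔ S m` puts it into `S m`. -/
theorem exists_eq_of_mem_M {y : K} (hy : y ∈ M m) :
    ∃ b c : F, ∃ g ∈ S m, y = q (b • e m) * t c * g := by
  have hmn : m < n := by omega
  obtain ⟨b, c, hbc⟩ := hb.fixesOffPair_smul_sub hs hm (hl.fixes_M m hm y hy) (f (m + 1))
  have hem := hb.e_mem_levelSpace (f := f) (e := e) (s := s) hmn (le_refl m)
  have hz : q (-b • e m) * t (-c) ∈ M m := mul_mem (hq.mem_line _) (hq.t_mem _)
  obtain ⟨g, hg, hgy⟩ := hl.exists_S m hmn (φ ((q (-b • e m) * t (-c))⁻¹ * y)) fun k hk hkm => by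
    have h1 := hl.fixes_M m hm y hy k hk
    have h2 := hl.fixes_M m hm _ hz k hk
    rw [map_mul, map_inv, mul_smul, mul_smul, inv_smul_eq_iff, inv_smul_eq_iff]
    refine ⟨h1.1.trans h2.1.symm, ?_⟩
    by_cases hkm' : k = m + 1
    · subst hkm'
      rw [hq.smul_f hs hb hm (Submodule.smul_mem _ _ hem), sub_eq_iff_eq_add.mp hbc]
      module
    · exact (h1.2 hkm hkm').trans (h2.2 hkm hkm').symm
  refine ⟨-b, -c, g, hg, ?_⟩
  have := (hl.inj_MS m hm m hmn).eq (Subgroup.mem_sup_right hg)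
    (Subgroup.mem_sup_left (mul_mem (inv_mem hz) hy)) hgy
  rw [this, mul_inv_cancel_left]

/-- The set of such products is stable under left multiplication by both generating subgroups: level
`m` acts by `conj`, and `M m` by `exists_eq_of_mem_M` and `q_mul`. -/
theorem exists_normal_form (hF : ∀ a b : F, ∃ c, c ≠ a ∧ c ≠ b)
    (ih : IsFaithfulLevel φ n e f M S m) {h : K} (hh : h ∈ liftedLevel M S m ⊔ M m) :
    ∃ v ∈ levelSpace s n e f m, ∃ c : F, ∃ g ∈ liftedLevel M S m, h = q v * t c * g := by
  have hem := hb.e_mem_levelSpace (f := f) (e := e) (s := s) (show m < n by omega) (le_refl m)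
  have step : ∀ x ∈ ((liftedLevel M S m : Subgroup K) : Set K) ∪ M m, ∀ h : K,
      (∃ v ∈ levelSpace s n e f m, ∃ c : F, ∃ g ∈ liftedLevel M S m, h = q v * t c * g) →
      (∃ v ∈ levelSpace s n e f m, ∃ c : F, ∃ g ∈ liftedLevel M S m, x * h = q v * t c * g) := by
    have hG : ∀ x ∈ liftedLevel M S m, ∀ v ∈ levelSpace s n e f m, ∀ c : F, ∀ g : K,
        x * (q v * t c * g) = q (φ x • v) * t c * (x * g) := fun x hx v hv c g => by
      rw [← hq.conj x hx v hv]
      have hc := hq.commute_t hs hb hl hm (Subgroup.mem_sup_left hx) c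
      calc x * (q v * t c * g) = x * q v * x⁻¹ * (x * t c) * g := by group
        _ = _ := by rw [hc.eq]; group
    rintro x (hx | hx) _ ⟨v, hv, c, g, hg, rfl⟩
    · exact ⟨φ x • v, IsHyperbolicSystem.smul_mem_levelSpace (hl.fixesAbove hx) hv, c, x * g,
        mul_mem hx hg, hG x hx v hv c g⟩
    · obtain ⟨b, c', σ, hσ, rfl⟩ := hq.exists_eq_of_mem_M hs hb hl hm hx
      have hσ' := S_le_liftedLevel (M := M) m hσ
      have hv' := IsHyperbolicSystem.smul_mem_levelSpace (hl.fixesAbove hσ') hv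
      have hbe := Submodule.smul_mem _ b hem
      refine ⟨b • e m + φ σ • v, add_mem hbe hv', s (φ σ • v) (b • e m) + (c' + c), σ * g,
        mul_mem hσ' hg, ?_⟩
      have hc := hq.commute_t hs hb hl hm (hq.mem (φ σ • v)) c'
      calc q (b • e m) * t c' * σ * (q v * t c * g)
          = q (b • e m) * t c' * (σ * (q v * t c * g)) := by group
        _ = q (b • e m) * (t c' * q (φ σ • v)) * t c * (σ * g) := by
          rw [hG σ hσ' v hv]; group
        _ = q (b • e m) * q (φ σ • v) * (t c' * t c) * (σ * g) := by rw [← hc.eq]; group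
        _ = _ := by
          rw [hq.q_mul hs hb hl hm hF ih hbe hv', hq.t_mul hs hl hm, mul_assoc (q _) (t _) (t _),
            hq.t_mul hs hl hm]
  rw [Subgroup.sup_eq_closure] at hh
  induction hh using Subgroup.closure_induction_left with
  | one => exact ⟨0, zero_mem _, 0, 1, one_mem _, by simp [hq.q_zero hl hm, hq.t_zero hl hm]⟩
  | mul_left x hx y _ ih => exact step x hx y ih
  | inv_mul_cancel x hx y _ ih =>
    refine step _ ?_ y ih
    rcases hx with hx | hx
    · exact .inl (inv_mem hx)
    · exact .inr (inv_mem hx)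

theorem injectiveOn (hF : ∀ a b : F, ∃ c, c ≠ a ∧ c ≠ b) (ih : IsFaithfulLevel φ n e f M S m) :
    InjectiveOn φ (liftedLevel M S m ⊔ M m) := by
  intro h hh h1
  obtain ⟨v, hv, c, g, hg, rfl⟩ := hq.exists_normal_form hs hb hl hm hF ih hh
  have hgf := (hl.fixesAbove hg (m + 1) hm (by omega)).2
  -- The factor in level `m` fixes `f (m + 1)`, so the image of that vector determines `v` and `c`.
  have hvf := hv _ hm (by omega)
  have h2 : φ (q v * t c * g) • f (m + 1) = f (m + 1) := by rw [h1, one_smul]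
  rw [map_mul, mul_smul, hgf, hq.smul_f hs hb hm hv, sub_sub, sub_eq_self] at h2
  have hc : c = 0 := by
    have := congrArg (fun x => s x (f (m + 1))) h2
    simpa [hvf.2, hb.e_f_self hm] using this
  rw [hc, zero_smul, add_zero] at h2
  rw [h2, hc, hq.q_zero hl hm, hq.t_zero hl hm, one_mul, one_mul] at h1 ⊢
  exact ih.inj g hg h1

end IsHeisenbergLift

namespace IsSlimLift

/-- Faithfulness of `H`, obtained from the normal form, is what yields `H_comm`: an element of `H`
fixing `f (m + 1)` has the same image as an element of level `m`, so it is that element and commutes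
with `S (m + 1)`. -/
theorem triangleData {m : ℕ} (hs : s.IsAlt) (hb : IsHyperbolicSystem s n e f)
    (hl : IsSlimLift φ n e f M S) (hm : m + 1 < n) (hF : ∀ a b : F, ∃ c, c ≠ a ∧ c ≠ b)
    (ih : IsFaithfulLevel φ n e f M S m) :
    TriangleData φ (levelSpace s n e f (m + 1)) (e (m + 1)) (f (m + 1)) (e m)
      (liftedLevel M S m ⊔ M m) (S (m + 1)) (M m ⊔ S (m + 1)) := by
  obtain ⟨q, t, hq⟩ := hl.exists_heisenberg_lift hs hb hm ih
  have hmn : m < n := by omega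
  have hem := hb.e_mem_levelSpace (f := f) (e := e) (s := s) hmn (le_refl m)
  have hinj := hq.injectiveOn hs hb hl hm hF ih
  have hef := hb.e_f_self hm
  have hlevel : ∀ v ∈ levelSpace s n e f (m + 1), s (e (m + 1)) v = 0 → s (f (m + 1)) v = 0 →
      v ∈ levelSpace s n e f m := fun v hv h1 h2 k hk hmk => by
    by_cases hk' : k = m + 1
    · subst hk'
      rw [hs.swap, h1, hs.swap v, h2, neg_zero]
      exact ⟨rfl, rfl⟩
    · exact hv k hk (by omega)
  have hHabove : ∀ h ∈ liftedLevel M S m ⊔ M m, FixesAbove n e f (m + 1) (φ h) ∧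
      φ h • e (m + 1) = e (m + 1) := by
    intro h hh
    have hle : ∀ k < n, m + 1 < k → liftedLevel M S m ⊔ M m ≤
        ((MulAction.stabilizer (Sp s) (e k)) ⊓ (MulAction.stabilizer (Sp s) (f k))).comap φ :=
      fun k hk hmk => sup_le (fun x hx => hl.fixesAbove hx k hk (by omega)) fun x hx =>
        ⟨(hl.fixes_M m hm x hx k hk).1, (hl.fixes_M m hm x hx k hk).2 (by omega) (by omega)⟩
    have hle' : liftedLevel M S m ⊔ M m ≤ (MulAction.stabilizer (Sp s) (e (m + 1))).comap φ :=
      sup_le (fun x hx => (hl.fixesAbove hx (m + 1) hm (by omega)).1) fun x hx =>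
        (hl.fixes_M m hm x hx _ hm).1
    exact ⟨fun k hk hmk => hle k hk hmk hh, hle' hh⟩
  have hS := fun x hx => hl.fixes_S (m + 1) hm x hx
  have hSfix : ∀ k ∈ M m ⊔ S (m + 1), φ k • e (m + 1) = e (m + 1) → k ∈ M m := by
    intro k hk hke
    have hle : ∀ j < n, j ≠ m + 1 → M m ⊔ S (m + 1) ≤ (MulAction.stabilizer (Sp s) (e j)).comap φ :=
      fun j hj hjm => sup_le (fun x hx => (hl.fixes_M m hm x hx j hj).1)
        fun x hx => (hS x hx j hj hjm).1
    have hle' : ∀ j < n, j ≠ m → j ≠ m + 1 →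
        M m ⊔ S (m + 1) ≤ (MulAction.stabilizer (Sp s) (f j)).comap φ :=
      fun j hj hj' hjm => sup_le (fun x hx => (hl.fixes_M m hm x hx j hj).2 hj' hjm)
        fun x hx => (hS x hx j hj hjm).2
    obtain ⟨y, hy, hyk⟩ := hl.exists_M m hm (φ k) fun j hj => by
      refine ⟨?_, fun h1 h2 => hle' j hj h1 h2 hk⟩
      by_cases hjm : j = m + 1
      · rw [hjm, hke]
      · exact hle j hj hjm hk
    rwa [(hl.inj_MS m hm _ hm).eq hk (Subgroup.mem_sup_left hy) hyk.symm]
  refine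
    { e_mem := hb.e_mem_levelSpace hm le_rfl
      f_mem := hb.f_mem_levelSpace hs hm le_rfl
      e_f := hef
      e_r := hb.e_e _ _ hm hmn
      f_r := by rw [hb.f_e hs hm hmn, if_neg (by omega)]
      H_mem := fun h hh v hv => IsHyperbolicSystem.smul_mem_levelSpace (hHabove h hh).1 hv
      H_fix := fun h hh => (hHabove h hh).2
      H_trans := ?_
      H_trans_fix := ?_
      H_comm := ?_
      S_mem := fun σ hσ v hv => IsHyperbolicSystem.smul_mem_levelSpace
        (fun k hk hmk => hS σ hσ k hk (by omega)) hv
      S_plane := fun σ hσ => hb.exists_plane hs hm (hS σ hσ) fun k hk hkm => by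
        simp [hb.e_e, hb.e_f, hk, hm, Ne.symm hkm]
      S_trans := ?_
      S_shear := ?_
      S_fix := fun σ hσ hσe =>
        Subgroup.mem_sup_right (hSfix σ (Subgroup.mem_sup_right hσ) hσe)
      S_le_W := le_sup_right
      W_space := ?_
      W_fix := fun k hk hke => Subgroup.mem_sup_right (hSfix k hk hke)
      W_trans := ?_ }
  · intro v hv hev
    set y := v - f (m + 1) + s (f (m + 1)) v • e (m + 1) with hy
    have hfe : s (f (m + 1)) (e (m + 1)) = -1 := by rw [hs.swap, hef]
    have hyl : y ∈ levelSpace s n e f m := by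
      refine hlevel y ?_ (by simp [hy, hev, hef, hs.self_eq_zero])
        (by simp [hy, hfe, hs.self_eq_zero])
      exact add_mem (sub_mem hv (hb.f_mem_levelSpace hs hm le_rfl))
        (Submodule.smul_mem _ _ (hb.e_mem_levelSpace hm le_rfl))
    refine ⟨q (-y) * t (s (f (m + 1)) v), mul_mem (hq.mem _) (Subgroup.mem_sup_right (hq.t_mem _)),
      ?_⟩
    rw [hq.smul_f hs hb hm (neg_mem hyl), hy]
    abel
  · intro v hv hev hfv hv0
    have hef' := hb.e_f_self hmn
    obtain ⟨g, hg, hgv⟩ := exists_fixOrthogonal_smul hs (hb.isNondegenerateOn_levelSpace hs m)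
      hem (hlevel v hv hev hfv) (fun h => by simp [h] at hef') hv0
    obtain ⟨x, hx, rfl⟩ := ih.surj g (IsHyperbolicSystem.fixesAbove_of_mem_fixOrthogonal hs hg)
    exact ⟨x, Subgroup.mem_sup_left hx, (hl.fixesAbove hx _ hm (by omega)).2, hgv⟩
  · intro h hh hhf σ hσ
    obtain ⟨x, hx, hxh⟩ := ih.surj (φ h) fun k hk hmk => by
      by_cases hkm : k = m + 1
      · subst hkm
        exact ⟨(hHabove h hh).2, hhf⟩
      · exact (hHabove h hh).1 k hk (by omega)
    rw [hinj.eq hh (Subgroup.mem_sup_left hx) hxh.symm]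
    exact hl.commute_S hs hb (by omega) hm hx hσ
  · intro a ha
    obtain ⟨g, hg, hge⟩ := hb.exists_fixesOffPlane_smul hs hm (a := 0) (.inr ha)
    obtain ⟨σ, hσ, rfl⟩ := hl.exists_S _ hm g hg
    exact ⟨σ, hσ, by rw [hge, zero_smul, zero_add]⟩
  · intro a
    obtain ⟨g, hg⟩ := Sp.exists_transvection hs (e (m + 1)) (-a)
    obtain ⟨σ, hσ, rfl⟩ := hl.exists_S _ hm g (hb.fixesOffPlane_of_isTransvection hs hm hg)
    refine ⟨σ, hσ, by rw [hg]; simp [hs.self_eq_zero], ?_⟩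
    rw [hg, hs.swap, hef]; simp
  · intro k hk
    have hle : ∀ j < n, (j ≠ m + 1 → M m ⊔ S (m + 1) ≤
        (MulAction.stabilizer (Sp s) (e j)).comap φ) := fun j hj hjm =>
      sup_le (fun x hx => (hl.fixes_M m hm x hx j hj).1) fun x hx => (hS x hx j hj hjm).1
    have hle' : ∀ j < n, j ≠ m → j ≠ m + 1 →
        M m ⊔ S (m + 1) ≤ (MulAction.stabilizer (Sp s) (f j)).comap φ :=
      fun j hj hj' hjm => sup_le (fun x hx => (hl.fixes_M m hm x hx j hj).2 hj' hjm)
        fun x hx => (hS x hx j hj hjm).2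
    refine ⟨_, _, _, hb.eq_triple hs hmn hm (by omega) fun j hj => ⟨fun h => ?_, fun h h' => ?_⟩⟩
    · rw [← show φ k • e j = e j from hle j hj h hk, Sp.form_smul, hb.e_e _ _ hm hj]
    · rw [← show φ k • f j = f j from hle' j hj h h' hk, Sp.form_smul, hb.e_f _ _ hm hj,
        if_neg h'.symm]
  · intro a b
    refine ⟨q (-b • e m) * t (-a), Subgroup.mem_sup_left (mul_mem (hq.mem_line _) (hq.t_mem _)),
      (hl.fixes_M m hm _ (mul_mem (hq.mem_line _) (hq.t_mem _)) _ hm).1, ?_⟩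
    rw [hq.smul_f hs hb hm (Submodule.smul_mem _ _ hem)]
    module

/-- By the triangle argument the stabilizer of `e (m + 1)` in level `m + 1` is `liftedLevel M S m ⊔
M m`. The kernel of `φ` lies in it, and it commutes with `M (m + 1)`. -/
theorem isFaithfulLevel_succ {m : ℕ} (hs : s.IsAlt) (hb : IsHyperbolicSystem s n e f)
    (hl : IsSlimLift φ n e f M S) (hm : m + 1 < n) (hF : ∀ a b : F, ∃ c, c ≠ a ∧ c ≠ b)
    (ih : IsFaithfulLevel φ n e f M S m) : IsFaithfulLevel φ n e f M S (m + 1) := by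
  have hd := hl.triangleData hs hb hm hF ih
  obtain ⟨q, t, hq⟩ := hl.exists_heisenberg_lift hs hb hm ih
  refine ⟨fun x hx hx1 => hq.injectiveOn hs hb hl hm hF ih x
    (hd.mem_of_smul_eq hs hx (by rw [hx1, one_smul])) hx1, ?_, ?_⟩
  · let N : Subgroup (Sp s) :=
      { carrier := {g | FixesAbove n e f (m + 1) g}
        one_mem' := fun k _ _ => ⟨one_smul _ _, one_smul _ _⟩
        mul_mem' := fun {g h} hg hh k hk hmk => by
          rw [mul_smul, mul_smul, (hh k hk hmk).1, (hh k hk hmk).2]; exact hg k hk hmk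
        inv_mem' := fun {g} hg k hk hmk => by
          rw [inv_smul_eq_iff, inv_smul_eq_iff, (hg k hk hmk).1, (hg k hk hmk).2]
          exact ⟨rfl, rfl⟩ }
    have hle : N ≤ (liftedLevel M S (m + 1)).map φ := by
      refine le_of_stabilizer_le (Y := levelSpace s n e f (m + 1)) hd.e_mem hd.f_mem
        (by rw [hd.e_f]; exact one_ne_zero)
        (fun g hg v hv => IsHyperbolicSystem.smul_mem_levelSpace hg hv) ?_ ?_
      · intro g hg hge
        obtain ⟨h, hh, hhf⟩ := hd.H_trans (g • f (m + 1))
          (IsHyperbolicSystem.smul_mem_levelSpace hg hd.f_mem) (by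
            conv_lhs => rw [← hge]
            rw [Sp.form_smul, hd.e_f])
        have hhN : φ h ∈ N := hl.fixesAbove (m := m + 1) (Subgroup.mem_sup_left hh)
        obtain ⟨x, hx, hxg⟩ := ih.surj ((φ h)⁻¹ * g) fun k hk hmk => by
          by_cases hkm : k = m + 1
          · subst hkm
            rw [mul_smul, mul_smul, inv_smul_eq_iff, inv_smul_eq_iff, hge, hd.H_fix h hh, hhf]
            exact ⟨rfl, rfl⟩
          · exact N.mul_mem (N.inv_mem hhN) hg k hk (by omega)
        exact ⟨h * x, mul_mem (Subgroup.mem_sup_left hh)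
          (Subgroup.mem_sup_left (Subgroup.mem_sup_left hx)),
          by rw [map_mul, hxg, mul_inv_cancel_left]⟩
      · intro v hv hev
        obtain ⟨h, hh, σ, hσ, heq, -⟩ := hd.exists_smul_eq hv hev
        have hmem : h * σ ∈ liftedLevel M S (m + 1) := Subgroup.mul_mem_sup hh hσ
        exact ⟨φ (h * σ), ⟨⟨_, hmem, rfl⟩, hl.fixesAbove hmem⟩, heq⟩
    exact fun g hg => hle hg
  · intro hm' x hx hxe y hy
    have hle : liftedLevel M S m ⊔ M m ≤ Subgroup.centralizer {y} := sup_le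
      (fun x hx => Subgroup.mem_centralizer_singleton_iff.mpr
        (hl.commute_M hs hb (by omega) hm' hx hy).eq)
      (fun x hx => Subgroup.mem_centralizer_singleton_iff.mpr
        (hl.commute_M_M hs hb hm hm' hx hy).eq)
    exact Subgroup.mem_centralizer_singleton_iff.mp (hle (hd.mem_of_smul_eq hs hx hxe))

theorem isFaithfulLevel (hs : s.IsAlt) (hb : IsHyperbolicSystem s n e f)
    (hl : IsSlimLift φ n e f M S) (hF : ∀ a b : F, ∃ c, c ≠ a ∧ c ≠ b) {m : ℕ} (hm : m < n) :
    IsFaithfulLevel φ n e f M S m := by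
  induction m with
  | zero => exact hl.isFaithfulLevel_zero hs hb hm
  | succ m ih => exact hl.isFaithfulLevel_succ hs hb hm hF (ih (by omega))

end IsSlimLift

end SlimInduction

/-! ### Generation and injectivity properties of the two kinds of completion. -/

section UniversalCompletion

variable {ι G : Type*} [Preorder ι] [Group G] (H : ι →o Subgroup G)

/-- The canonical homomorphism from a group of the amalgam to the universal completion. -/
def UniversalCompletion.of (i : ι) : H i →* UniversalCompletion H :=
  MonoidHom.mk' (fun a => PresentedGroup.of ⟨i, a⟩) fun a b => by
    have := PresentedGroup.one_of_mem (rels := amalgamRelators H) (.inl ⟨i, a, b, rfl⟩)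
    rw [map_mul, map_mul, map_inv, mul_inv_eq_one] at this
    exact this.symm

variable {H}

theorem UniversalCompletion.of_eq_of {i j : ι} (hij : i ≤ j) {g : G} (hi : g ∈ H i) (hj : g ∈ H j) :
    UniversalCompletion.of H i ⟨g, hi⟩ = UniversalCompletion.of H j ⟨g, hj⟩ := by
  have := PresentedGroup.one_of_mem (rels := amalgamRelators H) (.inr ⟨i, j, hij, ⟨g, hi⟩, rfl⟩)
  rw [map_mul, map_inv, mul_inv_eq_one] at this
  exact this

theorem UniversalCompletion.toAmbient_of (i : ι) (a : H i) :
    UniversalCompletion.toAmbient H (UniversalCompletion.of H i a) = a :=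
  PresentedGroup.toGroup.of _

variable (H) in
theorem UniversalCompletion.iSup_range_of :
    ⨆ i, (UniversalCompletion.of H i).range = ⊤ := by
  rw [eq_top_iff, ← PresentedGroup.closure_range_of, Subgroup.closure_le]
  rintro _ ⟨⟨i, a⟩, rfl⟩
  exact Subgroup.mem_iSup_of_mem i ⟨a, rfl⟩

/-- The index of the group `H a` in the amalgams indexed by small subsets. -/
def SmallSubset.single {α : Type*} (a : α) : SmallSubset α := ⟨{a}, by simp⟩

/-- The index of the pair `a, b` in the amalgams indexed by small subsets. -/
def SmallSubset.pair {α : Type*} [DecidableEq α] (a b : α) : SmallSubset α :=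
  ⟨{a, b}, by simp, Finset.card_le_two⟩

section Join

variable {α : Type*} (H : α → Subgroup G)

theorem joinAmalgam_single (a : α) : joinAmalgam H (SmallSubset.single a) = H a := by
  change ⨆ b ∈ ({a} : Finset α), H b = H a
  simp

/-- The image of `H a` in the universal completion of the amalgam of joins. -/
def joinLift (a : α) : Subgroup (UniversalCompletion (joinAmalgam H)) :=
  (UniversalCompletion.of (joinAmalgam H) (SmallSubset.single a)).range

theorem exists_joinLift {a : α} {g : G} (hg : g ∈ H a) :
    ∃ x ∈ joinLift H a, UniversalCompletion.toAmbient (joinAmalgam H) x = g := by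
  rw [← joinAmalgam_single H] at hg
  exact ⟨_, ⟨⟨g, hg⟩, rfl⟩, UniversalCompletion.toAmbient_of _ _⟩

theorem toAmbient_mem_of_joinLift {a : α} {x : UniversalCompletion (joinAmalgam H)}
    (hx : x ∈ joinLift H a) : UniversalCompletion.toAmbient (joinAmalgam H) x ∈ H a := by
  obtain ⟨y, rfl⟩ := hx
  rw [UniversalCompletion.toAmbient_of, ← joinAmalgam_single H]
  exact y.2

/-- Both lifts lie in the image of the amalgam member indexed by the pair, and that member embeds
because its composite with `toAmbient` is the inclusion. -/
theorem injectiveOn_joinLift (a b : α) :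
    InjectiveOn (UniversalCompletion.toAmbient (joinAmalgam H)) (joinLift H a ⊔ joinLift H b) := by
  classical
  have hle : joinLift H a ⊔ joinLift H b ≤
      (UniversalCompletion.of (joinAmalgam H) (SmallSubset.pair a b)).range := by
    have key : ∀ c, SmallSubset.single c ≤ SmallSubset.pair a b → joinLift H c ≤
        (UniversalCompletion.of (joinAmalgam H) (SmallSubset.pair a b)).range := by
      rintro c hc _ ⟨⟨g, hg⟩, rfl⟩
      exact ⟨⟨g, (joinAmalgam H).monotone hc hg⟩, (UniversalCompletion.of_eq_of hc _ _).symm⟩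
    refine sup_le (key a ?_) (key b ?_) <;> change (_ : Finset α) ⊆ _ <;>
      simp [SmallSubset.single, SmallSubset.pair]
  intro x hx hx1
  have hxr := hle hx
  obtain ⟨y, rfl⟩ := hxr
  rw [UniversalCompletion.toAmbient_of] at hx1
  have hy : y = 1 := Subtype.ext hx1
  rw [hy, map_one]

theorem iSup_joinLift : ⨆ a, joinLift H a = ⊤ := by
  rw [eq_top_iff, ← UniversalCompletion.iSup_range_of, iSup_le_iff]
  rintro K _ ⟨⟨g, hg⟩, rfl⟩
  have hle : joinAmalgam H K ≤
      ((⨆ a, joinLift H a).comap (UniversalCompletion.of (joinAmalgam H) K)).map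
        (joinAmalgam H K).subtype := by
    refine iSup₂_le fun a ha g hg => ?_
    have haK : SmallSubset.single a ≤ K := Finset.singleton_subset_iff.mpr ha
    have hg' : g ∈ joinAmalgam H (SmallSubset.single a) := by rwa [joinAmalgam_single]
    refine ⟨⟨g, (joinAmalgam H).monotone haK hg'⟩, ?_, rfl⟩
    change UniversalCompletion.of (joinAmalgam H) K _ ∈ ⨆ a, joinLift H a
    rw [← UniversalCompletion.of_eq_of haK hg']
    exact Subgroup.mem_iSup_of_mem a ⟨_, rfl⟩
  obtain ⟨y, hy, hyg⟩ := hle hg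
  have : y = ⟨g, hg⟩ := Subtype.ext hyg
  rwa [this] at hy

end Join

section Inter

variable {α : Type*} (H : α → Subgroup G)

theorem interAmalgam_single (a : α) :
    interAmalgam H (OrderDual.toDual (SmallSubset.single a)) = H a := by
  change ⨅ b ∈ ({a} : Finset α), H b = H a
  simp

/-- The image of `H a` in the universal completion of the amalgam of intersections. -/
def interLift (a : α) : Subgroup (UniversalCompletion (interAmalgam H)) :=
  (UniversalCompletion.of (interAmalgam H) (OrderDual.toDual (SmallSubset.single a))).range

theorem exists_interLift {a : α} {g : G} (hg : g ∈ H a) :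
    ∃ x ∈ interLift H a, UniversalCompletion.toAmbient (interAmalgam H) x = g := by
  rw [← interAmalgam_single H] at hg
  exact ⟨_, ⟨⟨g, hg⟩, rfl⟩, UniversalCompletion.toAmbient_of _ _⟩

theorem toAmbient_mem_of_interLift {a : α} {x : UniversalCompletion (interAmalgam H)}
    (hx : x ∈ interLift H a) : UniversalCompletion.toAmbient (interAmalgam H) x ∈ H a := by
  obtain ⟨y, rfl⟩ := hx
  rw [UniversalCompletion.toAmbient_of, ← interAmalgam_single H]
  exact y.2

/-- The common image lies in both groups, so both elements come from the intersection, which is a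
member of the amalgam. -/
theorem eq_of_interLift {a b : α} {x y : UniversalCompletion (interAmalgam H)}
    (hx : x ∈ interLift H a) (hy : y ∈ interLift H b)
    (hxy : UniversalCompletion.toAmbient (interAmalgam H) x =
      UniversalCompletion.toAmbient (interAmalgam H) y) : x = y := by
  classical
  obtain ⟨⟨g, hg⟩, rfl⟩ := hx
  obtain ⟨⟨g', hg'⟩, rfl⟩ := hy
  rw [UniversalCompletion.toAmbient_of, UniversalCompletion.toAmbient_of] at hxy
  obtain rfl : g = g' := hxy
  have hab : g ∈ interAmalgam H (OrderDual.toDual (SmallSubset.pair a b)) := by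
    rw [interAmalgam_single] at hg hg'
    change g ∈ ⨅ c ∈ ({a, b} : Finset α), H c
    simpa [Subgroup.mem_iInf] using ⟨hg, hg'⟩
  have key : ∀ c, SmallSubset.single c ≤ SmallSubset.pair a b →
      OrderDual.toDual (SmallSubset.pair a b) ≤ OrderDual.toDual (SmallSubset.single c) :=
    fun c h => OrderDual.toDual_le_toDual.mpr h
  rw [← UniversalCompletion.of_eq_of (key a ?_) hab, ← UniversalCompletion.of_eq_of (key b ?_) hab]
  all_goals
    change (_ : Finset α) ⊆ _
    simp [SmallSubset.single, SmallSubset.pair]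

theorem iSup_interLift : ⨆ a, interLift H a = ⊤ := by
  rw [eq_top_iff, ← UniversalCompletion.iSup_range_of, iSup_le_iff]
  rintro K _ ⟨⟨g, hg⟩, rfl⟩
  obtain ⟨a, ha⟩ := (OrderDual.ofDual K).2.1
  have haK : K ≤ OrderDual.toDual (SmallSubset.single a) :=
    OrderDual.le_toDual.mpr (Finset.singleton_subset_iff.mpr ha)
  rw [UniversalCompletion.of_eq_of haK hg ((interAmalgam H).monotone haK hg)]
  exact Subgroup.mem_iSup_of_mem a ⟨_, rfl⟩

end Inter

end UniversalCompletion

/-! ### The amalgam of maximal parabolics of a chamber. -/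

section Parabolic

variable {F V : Type*} [Field F] [AddCommGroup V] [Module F V] {s : LinearMap.BilinForm F V}

theorem mem_smul_submodule_iff {g : Sp s} {U : Submodule F V} {v : V} :
    v ∈ g • U ↔ ∃ u ∈ U, g • u = v :=
  Submodule.mem_smul_pointwise_iff_exists v (g : V ≃ₗ[F] V) U

theorem smul_submodule_eq {g : Sp s} {U : Submodule F V} (h : ∀ u ∈ U, g • u ∈ U)
    (h' : ∀ u ∈ U, g⁻¹ • u ∈ U) : g • U = U := by
  ext v
  rw [mem_smul_submodule_iff]
  constructor
  · rintro ⟨u, hu, rfl⟩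
    exact h u hu
  · exact fun hv => ⟨g⁻¹ • v, h' v hv, smul_inv_smul g v⟩

theorem smul_submodule_eq_of_fixes {g : Sp s} {U : Submodule F V} (h : ∀ u ∈ U, g • u = u) :
    g • U = U :=
  smul_submodule_eq (fun u hu => by rwa [h u hu]) fun u hu => by
    have : g⁻¹ • u = u := by rw [inv_smul_eq_iff, h u hu]
    rwa [this]

theorem smul_mem_of_smul_eq {g : Sp s} {U : Submodule F V} (h : g • U = U) {u : V} (hu : u ∈ U) :
    g • u ∈ U := by
  rw [← h]
  exact mem_smul_submodule_iff.mpr ⟨u, hu, rfl⟩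

theorem smul_mem_of_mem_fixOrthogonal [FiniteDimensional F V] (hs : s.IsAlt) (hnd : s.Nondegenerate)
    {Y : Submodule F V} {g : Sp s} (hg : g ∈ fixOrthogonal s Y) {y : V} (hy : y ∈ Y) :
    g • y ∈ Y := by
  rw [← LinearMap.BilinForm.orthogonal_orthogonal hnd hs.isRefl Y]
  rw [LinearMap.BilinForm.mem_orthogonal_iff]
  intro v hv
  have hv' : ∀ y ∈ Y, s v y = 0 := fun y hy => by
    rw [hs.swap, LinearMap.BilinForm.mem_orthogonal_iff.mp hv y hy, neg_zero]
  rw [← hg v hv']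
  exact (Sp.form_smul _ _ _).trans (hv' y hy)

theorem eq_span_pair_of_finrank_eq_two {W : Submodule F V} (hW : Module.finrank F W = 2) {u v : V}
    (hu : u ∈ W) (hv : v ∈ W) (hu0 : u ≠ 0) (huv : ∀ a : F, a • u ≠ v) :
    W = Submodule.span F {u, v} := by
  have : FiniteDimensional F W := FiniteDimensional.of_finrank_pos (by omega)
  have hli := (LinearIndependent.pair_iff' hu0).mpr huv
  have hcard := finrank_span_eq_card hli
  rw [Matrix.range_cons, Matrix.range_cons, Matrix.range_empty, Set.union_empty,
    Set.singleton_union, Fintype.card_fin] at hcard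
  refine (Submodule.eq_of_le_of_finrank_eq (Submodule.span_le.mpr ?_) (by omega)).symm
  rintro x (rfl | rfl)
  exacts [hu, hv]

/-- The vectors and members of a chamber that the proof uses: `Z` is the orthogonal complement of
`e`, `P` that of the hyperbolic pair `e, f`, and `R` is spanned by `r`. -/
structure IsAdapted (s : LinearMap.BilinForm F V) (C : Set (Submodule F V)) (e f r : V)
    (R P Z : C) : Prop where
  e_f : s e f = 1
  mem_Z : ∀ v, v ∈ Z.1 ↔ s e v = 0
  mem_P : ∀ v, v ∈ P.1 ↔ s e v = 0 ∧ s f v = 0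
  mem_R : ∀ v, v ∈ R.1 ↔ ∃ a : F, a • r = v
  r_ne_zero : r ≠ 0
  r_mem : r ∈ P.1
  le_or_eq : ∀ X : C, X.1 ≤ P.1 ∨ X = Z

theorem IsChamber.exists_isAdapted {n : ℕ} (hn : 2 ≤ n) (hV : Module.finrank F V = 2 * n)
    (hs : s.IsAlt) (hnd : s.Nondegenerate) {C : Set (Submodule F V)} (hC : IsChamber s C) :
    ∃ (e f r : V) (R P Z : C), IsAdapted s C e f r R P Z := by
  have : FiniteDimensional F V := FiniteDimensional.of_finrank_pos (by omega)
  have hcomp : ∀ X ∈ C, ∀ Y ∈ C, Module.finrank F X ≤ Module.finrank F Y → X ≤ Y := by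
    intro X hX Y hY hXY
    rcases hC.incident X hX Y hY with h | h | h
    · exact h.le
    · exact h.1
    · exact (Submodule.eq_of_le_of_finrank_le h.1 hXY).ge
  obtain ⟨R, hR, hR1⟩ := hC.types 1 one_pos (by omega)
  obtain ⟨P, hP, hP1⟩ := hC.types (2 * n - 2) (by omega) (by omega)
  obtain ⟨Z, hZ, hZ1⟩ := hC.types (2 * n - 1) (by omega) (by omega)
  have hZd : Module.finrank F (s.orthogonal Z) = 1 := by
    rw [LinearMap.BilinForm.finrank_orthogonal hnd]; omega
  have hPd : Module.finrank F (s.orthogonal P) = 2 := by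
    rw [LinearMap.BilinForm.finrank_orthogonal hnd]; omega
  obtain ⟨⟨e, heZ⟩, he0, hespan⟩ := finrank_eq_one_iff'.mp hZd
  have he0' : e ≠ 0 := fun h => he0 (Subtype.ext h)
  have hPZ : P ≤ Z := hcomp P hP Z hZ (by omega)
  have heP : e ∈ s.orthogonal P := LinearMap.BilinForm.orthogonal_le hPZ heZ
  have hmemZ : ∀ v, v ∈ Z ↔ s e v = 0 := by
    intro v
    rw [← LinearMap.BilinForm.orthogonal_orthogonal hnd hs.isRefl Z,
      LinearMap.BilinForm.mem_orthogonal_iff]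
    refine ⟨fun h => h e heZ, fun h y hy => ?_⟩
    obtain ⟨c, hc⟩ := hespan ⟨y, hy⟩
    have : c • e = y := congrArg Subtype.val hc
    rw [← this, map_smul, LinearMap.smul_apply, h, smul_zero]
  -- If `e` were orthogonal to the two-dimensional `P^⊥`, then `P^⊥` would be totally isotropic and
  -- contained in the radical of `P`, which has dimension at most one.
  obtain ⟨f, hfP, hef⟩ : ∃ f ∈ s.orthogonal P, s e f = 1 := by
    by_contra! hcon
    have hperp : ∀ f ∈ s.orthogonal P, s e f = 0 := fun f hf => by
      by_contra h
      exact hcon ((s e f)⁻¹ • f) (Submodule.smul_mem _ _ hf)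
        (by rw [map_smul, smul_eq_mul, inv_mul_cancel₀ h])
    have hle : s.orthogonal P ≤ radical s P := by
      refine le_inf ?_ le_rfl
      conv_rhs => rw [← LinearMap.BilinForm.orthogonal_orthogonal hnd hs.isRefl P]
      obtain ⟨y, hy, hye⟩ : ∃ y ∈ s.orthogonal P, y ∉ Submodule.span F {e} := by
        by_contra! hno
        have h1 := Submodule.finrank_mono (show s.orthogonal P ≤ Submodule.span F {e} from hno)
        rw [finrank_span_singleton he0'] at h1
        omega
      rw [eq_span_pair_of_finrank_eq_two hPd heP hy he0' fun a ha =>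
        hye (Submodule.mem_span_singleton.mpr ⟨a, ha⟩)]
      refine fun u hu => LinearMap.BilinForm.mem_orthogonal_iff.mpr fun v hv => ?_
      obtain ⟨a, b, rfl⟩ := Submodule.mem_span_pair.mp hu
      obtain ⟨c, d, rfl⟩ := Submodule.mem_span_pair.mp hv
      have hey := hperp y hy
      simp [hs.self_eq_zero, hey, hs.swap y e]
    have := Submodule.finrank_mono hle
    have := (hC.isObject P hP).finrank_radical_le
    omega
  have hPspan := eq_span_pair_of_finrank_eq_two hPd heP hfP he0' fun a ha => by
    rw [← ha, map_smul, hs.self_eq_zero, smul_zero] at hef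
    exact zero_ne_one hef
  have hmemP : ∀ v, v ∈ P ↔ s e v = 0 ∧ s f v = 0 := by
    intro v
    rw [← LinearMap.BilinForm.orthogonal_orthogonal hnd hs.isRefl P,
      LinearMap.BilinForm.mem_orthogonal_iff]
    refine ⟨fun h => ⟨h e heP, h f hfP⟩, fun h y hy => ?_⟩
    rw [hPspan] at hy
    obtain ⟨a, b, rfl⟩ := Submodule.mem_span_pair.mp hy
    simp [h.1, h.2]
  obtain ⟨⟨r, hr⟩, hr0, hrspan⟩ := finrank_eq_one_iff'.mp hR1
  refine ⟨e, f, r, ⟨R, hR⟩, ⟨P, hP⟩, ⟨Z, hZ⟩, hef, hmemZ, hmemP, fun v => ⟨fun hv => ?_, ?_⟩,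
    fun h => hr0 (Subtype.ext h), hcomp R hR P hP (by omega) hr, ?_⟩
  · obtain ⟨c, hc⟩ := hrspan ⟨v, hv⟩
    exact ⟨c, congrArg Subtype.val hc⟩
  · rintro ⟨a, rfl⟩
    exact Submodule.smul_mem _ a hr
  · rintro ⟨X, hX⟩
    by_cases h : Module.finrank F X ≤ 2 * n - 2
    · exact .inl (hcomp X hX P hP (by omega))
    · have hXt := Submodule.finrank_lt (hC.isObject X hX).ne_top
      have hXZ := hcomp X hX Z hZ (by omega)
      exact .inr (Subtype.ext (Submodule.eq_of_le_of_finrank_eq hXZ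
        (show Module.finrank F X = Module.finrank F Z by omega)))

/-- Subgroups of `K` that lift the stabilizers of the members of `C`, compatibly. -/
structure IsParabolicLift {K : Type*} [Group K] (φ : K →* Sp s) (C : Set (Submodule F V))
    (L : C → Subgroup K) : Prop where
  exists_lift : ∀ X : C, ∀ g : Sp s, g • X.1 = X.1 → ∃ x ∈ L X, φ x = g
  smul_eq : ∀ X : C, ∀ x ∈ L X, φ x • X.1 = X.1
  glue : ∀ X Y : C, ∀ x ∈ L X, ∀ y ∈ L Y, φ x = φ y → x = y
  generate : ⨆ X, L X = ⊤

namespace IsParabolicLift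

variable {K : Type*} [Group K] {φ : K →* Sp s} {C : Set (Submodule F V)} {L : C → Subgroup K}
  (hs : s.IsAlt) (hL : IsParabolicLift φ C L) {e f r : V} {R P Z : C}
  (hA : IsAdapted s C e f r R P Z)
include hs hL hA

omit hs hA in
theorem mem_of_smul_eq {X Y : C} {x : K} (hx : x ∈ L X) (h : φ x • Y.1 = Y.1) : x ∈ L Y := by
  obtain ⟨y, hy, hyx⟩ := hL.exists_lift Y _ h
  rwa [hL.glue X Y x hx y hy hyx.symm]

omit hs hL in
theorem smul_Z {g : Sp s} {a : F} (ha : a ≠ 0) (hg : g • e = a • e) : g • Z.1 = Z.1 := by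
  have hg' : g⁻¹ • e = a⁻¹ • e := by
    rw [inv_smul_eq_iff, smul_comm, hg, inv_smul_smul₀ ha]
  refine smul_submodule_eq (fun u hu => ?_) fun u hu => ?_ <;> rw [hA.mem_Z] at hu ⊢
  · rw [Sp.form_smul_right, hg', map_smul, LinearMap.smul_apply, hu, smul_zero]
  · rw [Sp.form_smul_right, inv_inv, hg, map_smul, LinearMap.smul_apply, hu, smul_zero]

omit hs hL in
theorem smul_P {g : Sp s} (he : g • e = e) (hf : g • f = f) : g • P.1 = P.1 := by
  refine smul_submodule_eq (fun u hu => ?_) fun u hu => ?_ <;> rw [hA.mem_P] at hu ⊢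
  · constructor
    · rw [← he, Sp.form_smul, hu.1]
    · rw [← hf, Sp.form_smul, hu.2]
  · rw [Sp.form_smul_right, Sp.form_smul_right, inv_inv, he, hf]
    exact hu

omit hs hL in
theorem smul_R {g : Sp s} (hr : g • r = r) : g • R.1 = R.1 :=
  smul_submodule_eq_of_fixes fun u hu => by
    obtain ⟨a, rfl⟩ := (hA.mem_R u).mp hu
    rw [smul_comm, hr]

omit hL in
theorem fixes_P {g : Sp s} (hg : g ∈ fixOrthogonal s (Submodule.span F {e, f})) {u : V}
    (hu : u ∈ P.1) : g • u = u := hg u fun y hy => by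
  obtain ⟨a, b, rfl⟩ := Submodule.mem_span_pair.mp hy
  have h := (hA.mem_P u).mp hu
  simp [hs.swap u e, hs.swap u f, h.1, h.2]

omit hL in
theorem commute_of_fixes [FiniteDimensional F V] {g h : Sp s}
    (hnd : s.Nondegenerate)
    (hg : g ∈ fixOrthogonal s (Submodule.span F {e, f})) (he : h • e = e) (hf : h • f = f) :
    Commute h g := Sp.ext_smul fun v => by
  have hef := hA.e_f
  have hfe : s f e = -1 := by rw [hs.swap, hef]
  have hplane : ∀ y ∈ Submodule.span F {e, f}, h • g • y = g • h • y := fun y hy => by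
    have hfix : ∀ y ∈ Submodule.span F {e, f}, h • y = y := fun y hy => by
      obtain ⟨a, b, rfl⟩ := Submodule.mem_span_pair.mp hy
      rw [smul_add, smul_comm, he, smul_comm, hf]
    rw [hfix y hy, hfix _ (smul_mem_of_mem_fixOrthogonal hs hnd hg hy)]
  obtain ⟨y, hy, u, hu, rfl⟩ : ∃ y ∈ Submodule.span F {e, f}, ∃ u ∈ P.1, v = y + u := by
    refine ⟨-s f v • e + s e v • f, Submodule.mem_span_pair.mpr ⟨_, _, rfl⟩,
      v + s f v • e - s e v • f, (hA.mem_P _).mpr ?_, by module⟩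
    simp [hs.self_eq_zero, hef, hfe]
  simp only [mul_smul, smul_add]
  rw [hplane y hy, fixes_P hs hA hg hu, fixes_P hs hA hg
    (smul_mem_of_smul_eq (smul_P hA he hf) hu)]

/-- The lift of the stabilizer of `e`. -/
def vectorLift (_ : IsParabolicLift φ C L) (e : V) (Z : C) : Subgroup K :=
  L Z ⊓ (MulAction.stabilizer (Sp s) e).comap φ

/-- The lift of the group of elements that act trivially on the orthogonal complement of `Y`. -/
def fixLift (_ : IsParabolicLift φ C L) (Y : Submodule F V) (X : C) : Subgroup K :=
  L X ⊓ (fixOrthogonal s Y).comap φ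

omit hs in
theorem exists_vectorLift {g : Sp s} (hg : g • e = e) : ∃ x ∈ hL.vectorLift e Z, φ x = g := by
  obtain ⟨x, hx, rfl⟩ := hL.exists_lift Z g (smul_Z hA one_ne_zero (by rw [hg, one_smul]))
  exact ⟨x, ⟨hx, hg⟩, rfl⟩

theorem exists_fixLift {g : Sp s} (hg : g ∈ fixOrthogonal s (Submodule.span F {e, f})) :
    ∃ x ∈ hL.fixLift (Submodule.span F {e, f}) P, φ x = g := by
  obtain ⟨x, hx, rfl⟩ := hL.exists_lift P g
    (smul_submodule_eq_of_fixes fun u hu => fixes_P hs hA hg hu)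
  exact ⟨x, ⟨hx, hg⟩, rfl⟩

omit hs in
theorem mem_vectorLift_of_mem {X : C} {x : K} (hx : x ∈ L X) (hxe : φ x • e = e) :
    x ∈ hL.vectorLift e Z :=
  ⟨hL.mem_of_smul_eq hx (smul_Z hA one_ne_zero (by rw [hxe, one_smul])), hxe⟩

/-- The gluing relation moves an element from one lifted parabolic to another whenever its image
stabilizes both members. So `S` sits in `W` because its elements fix `r`, and the part of `H` fixing
`f` commutes with `S` because both lie in `L P`. -/
theorem triangleData [FiniteDimensional F V] (hnd : s.Nondegenerate) :
    TriangleData φ ⊤ e f r (hL.vectorLift e Z) (hL.fixLift (Submodule.span F {e, f}) P)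
      (hL.fixLift (Submodule.span F {e, f, r}) R) := by
  have hef := hA.e_f
  have hfe : s f e = -1 := by rw [hs.swap, hef]
  have hr := (hA.mem_P r).mp hA.r_mem
  have hef0 : s e f ≠ 0 := by rw [hef]; exact one_ne_zero
  have he2 : e ∈ Submodule.span F {e, f} := Submodule.subset_span (by simp)
  have hf2 : f ∈ Submodule.span F {e, f} := Submodule.subset_span (by simp)
  have he3 : e ∈ Submodule.span F {e, f, r} := Submodule.subset_span (by simp)
  have hf3 : f ∈ Submodule.span F {e, f, r} := Submodule.subset_span (by simp)
  have hr3 : r ∈ Submodule.span F {e, f, r} := Submodule.subset_span (by simp)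
  have hfixr : ∀ g ∈ fixOrthogonal s (Submodule.span F {e, f, r}), g • r = r := fun g hg =>
    hg r fun y hy => by
      obtain ⟨a, b, c, rfl⟩ := Submodule.mem_span_triple.mp hy
      simp [hs.self_eq_zero, hs.swap r e, hs.swap r f, hr.1, hr.2]
  refine
    { e_mem := trivial
      f_mem := trivial
      e_f := hef
      e_r := hr.1
      f_r := hr.2
      H_mem := fun _ _ _ _ => trivial
      H_fix := fun h hh => hh.2
      H_trans := ?_
      H_trans_fix := ?_
      H_comm := ?_
      S_mem := fun _ _ _ _ => trivial
      S_plane := ?_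
      S_trans := ?_
      S_shear := ?_
      S_fix := fun σ hσ hσe => hL.mem_vectorLift_of_mem hA hσ.1 hσe
      S_le_W := ?_
      W_space := ?_
      W_fix := fun k hk hke => hL.mem_vectorLift_of_mem hA hk.1 hke
      W_trans := ?_ }
  · intro v _ hev
    obtain ⟨g, -, hge, hgf⟩ := exists_fixOrthogonal_smul_fix hs (Y := ⊤) (e := e) (u := f) (v := v)
      trivial trivial trivial hef0 (hef.trans hev.symm)
    obtain ⟨x, hx, rfl⟩ := hL.exists_vectorLift hA hge
    exact ⟨x, hx, hgf⟩
  · intro v _ hev hfv hv0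
    have hnP : IsNondegenerateOn s P.1 := by
      intro u hu hu0
      obtain ⟨y, hy⟩ : ∃ y, s u y ≠ 0 := by
        by_contra! h
        exact hu0 (hnd.1 u h)
      have hu' := (hA.mem_P u).mp hu
      refine ⟨y + s f y • e - s e y • f, (hA.mem_P _).mpr ?_, ?_⟩
      · simp [hs.self_eq_zero, hef, hfe]
      · simpa [hs.swap u e, hs.swap u f, hu'.1, hu'.2] using hy
    obtain ⟨g, hg, hgr⟩ := exists_fixOrthogonal_smul hs hnP hA.r_mem ((hA.mem_P v).mpr ⟨hev, hfv⟩)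
      hA.r_ne_zero hv0
    obtain ⟨x, hx, rfl⟩ := hL.exists_vectorLift hA
      (hg e fun y hy => ((hA.mem_P y).mp hy).1)
    exact ⟨x, hx, hg f fun y hy => ((hA.mem_P y).mp hy).2, hgr⟩
  · intro h hh hhf σ hσ
    have hhP := hL.mem_of_smul_eq hh.1 (smul_P hA hh.2 hhf)
    refine hL.glue P P _ (mul_mem hhP hσ.1) _ (mul_mem hσ.1 hhP) ?_
    rw [map_mul, map_mul]
    exact (commute_of_fixes hs hA hnd hσ.2 hh.2 hhf).eq
  · intro σ hσ
    obtain ⟨a, b, hab⟩ := Submodule.mem_span_pair.mp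
      (smul_mem_of_mem_fixOrthogonal hs hnd hσ.2 he2)
    exact ⟨a, b, hab.symm⟩
  · intro a ha
    obtain ⟨g, hg, hge, -⟩ := exists_fixOrthogonal_smul_of_ne hs he2
      (Submodule.smul_mem _ a hf2) (by rwa [map_smul, hef, smul_eq_mul, mul_one])
    obtain ⟨x, hx, rfl⟩ := hL.exists_fixLift hs hA hg
    exact ⟨x, hx, hge⟩
  · intro a
    obtain ⟨g, hg⟩ := Sp.exists_transvection hs e (-a)
    obtain ⟨x, hx, rfl⟩ := hL.exists_fixLift hs hA (mem_fixOrthogonal_of_transvection he2 hg)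
    refine ⟨x, hx, by rw [hg]; simp [hs.self_eq_zero], by rw [hg, hfe]; simp⟩
  · intro σ hσ
    have hσ3 : φ σ ∈ fixOrthogonal s (Submodule.span F {e, f, r}) := fun v hv =>
      hσ.2 v fun y hy => hv y (Submodule.span_mono (by grind) hy)
    exact ⟨hL.mem_of_smul_eq hσ.1 (smul_R hA (hfixr _ hσ3)), hσ3⟩
  · intro k hk
    obtain ⟨a, b, c, habc⟩ := Submodule.mem_span_triple.mp
      (smul_mem_of_mem_fixOrthogonal hs hnd hk.2 he3)
    exact ⟨a, b, c, habc.symm⟩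
  · intro a b
    obtain ⟨g, hg, hge, hgf⟩ := exists_fixOrthogonal_smul_fix hs he3 hf3
      (add_mem (add_mem (Submodule.smul_mem _ a he3) hf3) (Submodule.smul_mem _ b hr3)) hef0
      (by simp [hs.self_eq_zero, hr.1])
    obtain ⟨x, hx, rfl⟩ := hL.exists_lift R g (smul_R hA (hfixr g hg))
    exact ⟨x, ⟨hx, hg⟩, hge, hgf⟩

/-- For `X` inside `P`, the vectors `e` and `f` lie in `X^⊥`, and `le_of_stabilizer_le` applies to
the action on `X^⊥`. For `X = Z` the stabilizer preserves the line of `e`, and a diagonal element of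
`S` corrects the scalar. -/
theorem lift_le [FiniteDimensional F V] (hnd : s.Nondegenerate) (X : C) :
    L X ≤ hL.vectorLift e Z ⊔ hL.fixLift (Submodule.span F {e, f}) P := by
  have hef := hA.e_f
  have hef0 : s e f ≠ 0 := by rw [hef]; exact one_ne_zero
  have he2 : e ∈ Submodule.span F {e, f} := Submodule.subset_span (by simp)
  have hf2 : f ∈ Submodule.span F {e, f} := Submodule.subset_span (by simp)
  have hd := hL.triangleData hs hA hnd
  rcases hA.le_or_eq X with hXP | rfl
  · have hle : MulAction.stabilizer (Sp s) X.1 ≤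
        (L X ⊓ (hL.vectorLift e Z ⊔ hL.fixLift (Submodule.span F {e, f}) P)).map φ := by
      have hXe : ∀ x ∈ X.1, s e x = 0 ∧ s f x = 0 := fun x hx => (hA.mem_P x).mp (hXP hx)
      have hmem : ∀ v, v ∈ s.orthogonal X.1 ↔ ∀ x ∈ X.1, s x v = 0 := fun v =>
        LinearMap.BilinForm.mem_orthogonal_iff
      have heX : e ∈ s.orthogonal X.1 := (hmem e).mpr fun x hx => by
        rw [hs.swap, (hXe x hx).1, neg_zero]
      have hfX : f ∈ s.orthogonal X.1 := (hmem f).mpr fun x hx => by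
        rw [hs.swap, (hXe x hx).2, neg_zero]
      refine le_of_stabilizer_le (Y := s.orthogonal X.1) heX hfX hef0 ?_ ?_ ?_
      · intro g hg v hv
        refine (hmem _).mpr fun x hx => ?_
        rw [Sp.form_smul_right]
        exact (hmem v).mp hv _ (smul_mem_of_smul_eq (inv_mem hg) hx)
      · intro g hg hge
        obtain ⟨x, hx, rfl⟩ := hL.exists_lift X g hg
        exact ⟨x, ⟨hx, Subgroup.mem_sup_left (hL.mem_vectorLift_of_mem hA hx hge)⟩, rfl⟩
      · intro v hv hev
        obtain ⟨σ, hσ, hσe⟩ := hd.S_trans _ hev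
        obtain ⟨g, hg, hge, hgf⟩ := exists_fixOrthogonal_smul_fix hs heX hfX
          (Submodule.smul_mem _ (s e v)⁻¹ hv) hef0
          (by rw [map_smul, smul_eq_mul, inv_mul_cancel₀ hev, hef])
        obtain ⟨h, hh, rfl⟩ := hL.exists_vectorLift hA hge
        have hσX : σ ∈ L X := hL.mem_of_smul_eq hσ.1
          (smul_submodule_eq_of_fixes fun u hu => fixes_P hs hA hσ.2 (hXP hu))
        have hhX : h ∈ L X := hL.mem_of_smul_eq hh.1
          (smul_submodule_eq_of_fixes fun u hu => hg u fun y hy => (hmem y).mp hy u hu)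
        refine ⟨φ (h * σ), ⟨⟨h * σ, ⟨mul_mem hhX hσX, Subgroup.mul_mem_sup hh hσ⟩, rfl⟩,
          hL.smul_eq X _ (mul_mem hhX hσX)⟩, ?_⟩
        rw [map_mul, mul_smul, hσe, smul_comm, hgf, smul_inv_smul₀ hev]
    intro x hx
    obtain ⟨y, hy, hyx⟩ := hle (hL.smul_eq X x hx)
    rw [hL.glue X X x hx y hy.1 hyx.symm]
    exact hy.2
  · intro x hx
    have hgX := hL.smul_eq X x hx
    obtain ⟨a, ha⟩ : ∃ a : F, a • e = φ x • e := by
      have horth : s.orthogonal (Submodule.span F {e}) = X.1 := by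
        ext v
        rw [LinearMap.BilinForm.mem_orthogonal_iff, hA.mem_Z]
        refine ⟨fun h => h e (Submodule.mem_span_singleton_self e), fun h y hy => ?_⟩
        obtain ⟨c, rfl⟩ := Submodule.mem_span_singleton.mp hy
        rw [map_smul, LinearMap.smul_apply, h, smul_zero]
      rw [← Submodule.mem_span_singleton,
        ← LinearMap.BilinForm.orthogonal_orthogonal hnd hs.isRefl (Submodule.span F {e}), horth,
        LinearMap.BilinForm.mem_orthogonal_iff]
      intro v hv
      have hv' : (φ x)⁻¹ • v ∈ X.1 :=
        smul_mem_of_smul_eq ((MulAction.stabilizer (Sp s) X.1).inv_mem hgX) hv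
      refine (Sp.form_smul_right (φ x) v e).trans ?_
      rw [hs.swap, (hA.mem_Z _).mp hv', neg_zero]
    have he0 : e ≠ 0 := fun h => hef0 (by rw [h]; simp)
    have ha0 : a ≠ 0 := fun h => by
      rw [h, zero_smul, eq_comm, smul_eq_zero_iff_eq] at ha
      exact he0 ha
    -- A single transvection of this kind cannot take `e` to `a • e`, since the two are orthogonal;
    -- the route goes through `f`.
    obtain ⟨g₁, hg₁, hge, -⟩ := exists_fixOrthogonal_smul_of_ne hs he2 hf2 hef0
    obtain ⟨g₂, hg₂, hgf, -⟩ := exists_fixOrthogonal_smul_of_ne hs hf2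
      (Submodule.smul_mem _ a he2) (by rw [map_smul, hs.swap, hef]; simpa using ha0)
    obtain ⟨σ, hσ, hσg⟩ := hL.exists_fixLift hs hA (mul_mem hg₂ hg₁)
    have hσe : φ σ • e = a • e := by rw [hσg, mul_smul, hge, hgf]
    have hσX := hL.mem_of_smul_eq hσ.1 (smul_Z hA ha0 hσe)
    rw [← mul_inv_cancel_left σ x]
    refine mul_mem (Subgroup.mem_sup_right hσ) (Subgroup.mem_sup_left ⟨?_, ?_⟩)
    · exact (L X).mul_mem ((L X).inv_mem hσX) hx
    · change φ (σ⁻¹ * x) • e = e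
      rw [map_mul, map_inv, mul_smul, ← ha, ← hσe, inv_smul_smul]

theorem bijective [FiniteDimensional F V] (hnd : s.Nondegenerate) : Function.Bijective φ := by
  have hd := hL.triangleData hs hA hnd
  have htop : hL.vectorLift e Z ⊔ hL.fixLift (Submodule.span F {e, f}) P = ⊤ := by
    rw [eq_top_iff, ← hL.generate]
    exact iSup_le fun X => hL.lift_le hs hA hnd X
  constructor
  · rw [injective_iff_map_eq_one]
    intro x hx
    have := hd.mem_of_smul_eq hs (k := x) (htop ▸ Subgroup.mem_top x) (by rw [hx, one_smul])
    exact hL.glue Z Z x this.1 1 (one_mem _) (by rw [hx, map_one])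
  · rw [← MonoidHom.range_eq_top, eq_top_iff]
    refine le_of_stabilizer_le (Y := ⊤) (e := e) (f := f) trivial trivial
      (by rw [hA.e_f]; exact one_ne_zero) (fun _ _ _ _ => trivial) ?_ ?_
    · intro g _ hge
      obtain ⟨x, -, rfl⟩ := hL.exists_vectorLift hA hge
      exact ⟨x, rfl⟩
    · intro v hv hev
      obtain ⟨h, -, σ, -, heq, -⟩ := hd.exists_smul_eq hv hev
      exact ⟨_, ⟨⟨_, rfl⟩, trivial⟩, heq⟩

end IsParabolicLift

theorem isUniversalCompletion_parabolicAmalgam {n : ℕ} (hn : 2 ≤ n)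
    (hV : Module.finrank F V = 2 * n) (hs : s.IsAlt) (hnd : s.Nondegenerate)
    {C : Set (Submodule F V)} (hC : IsChamber s C) :
    IsUniversalCompletion (parabolicAmalgam s C) := by
  have : FiniteDimensional F V := FiniteDimensional.of_finrank_pos (by omega)
  obtain ⟨e, f, r, R, P, Z, hA⟩ := hC.exists_isAdapted hn hV hs hnd
  have hL : IsParabolicLift (UniversalCompletion.toAmbient (parabolicAmalgam s C)) C
      (interLift fun X : C => MulAction.stabilizer (Sp s) (X : Submodule F V)) :=
    { exists_lift := fun X g hg => exists_interLift _ hg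
      smul_eq := fun X x hx => toAmbient_mem_of_interLift _ hx
      glue := fun X Y x hx y hy hxy => eq_of_interLift _ hx hy hxy
      generate := iSup_interLift _ }
  exact hL.bijective hs hA hnd

end Parabolic

/-! ### The isomorphism types of the groups of the slim amalgam. -/

section Isomorphisms

variable {F V : Type*} [Field F] [AddCommGroup V] [Module F V] {s : LinearMap.BilinForm F V}
  {n : ℕ} {e f : ℕ → V}

/-- The `2 × 2` matrix with rows `a b` and `c d`, with indices in `Fin 1 ⊕ Fin 1`. -/
def planeMatrix (a b c d : F) : Matrix (Fin 1 ⊕ Fin 1) (Fin 1 ⊕ Fin 1) F :=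
  Matrix.fromBlocks (.of fun _ _ => a) (.of fun _ _ => b) (.of fun _ _ => c) (.of fun _ _ => d)

theorem planeMatrix_mem {a b c d : F} :
    planeMatrix a b c d ∈ Matrix.symplecticGroup (Fin 1) F ↔ a * d - b * c = 1 := by
  rw [SymplecticGroup.mem_iff, planeMatrix, Matrix.J, Matrix.fromBlocks_transpose,
    Matrix.fromBlocks_multiply, Matrix.fromBlocks_multiply, Matrix.fromBlocks_inj]
  simp only [← Matrix.ext_iff, Fin.forall_fin_one]
  simp [Matrix.mul_apply, Matrix.transpose_apply]
  constructor
  · rintro ⟨-, h, -⟩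
    linear_combination -h
  · intro h
    refine ⟨by ring, by linear_combination -h, by linear_combination h, by ring⟩

theorem planeMatrix_mul (a b c d a' b' c' d' : F) :
    planeMatrix a b c d * planeMatrix a' b' c' d' =
      planeMatrix (a * a' + b * c') (a * b' + b * d') (c * a' + d * c') (c * b' + d * d') := by
  rw [planeMatrix, planeMatrix, Matrix.fromBlocks_multiply, planeMatrix, Matrix.fromBlocks_inj]
  simp only [← Matrix.ext_iff, Fin.forall_fin_one]
  simp [Matrix.mul_apply]

omit [Field F] in
theorem exists_eq_planeMatrix (A : Matrix (Fin 1 ⊕ Fin 1) (Fin 1 ⊕ Fin 1) F) :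
    ∃ a b c d, A = planeMatrix a b c d := by
  refine ⟨A (.inl 0) (.inl 0), A (.inl 0) (.inr 0), A (.inr 0) (.inl 0), A (.inr 0) (.inr 0), ?_⟩
  ext (i | i) (j | j) <;> fin_cases i <;> fin_cases j <;> rfl

omit [Field F] in
theorem planeMatrix_inj {a b c d a' b' c' d' : F} (h : planeMatrix a b c d = planeMatrix a' b' c' d') :
    a = a' ∧ b = b' ∧ c = c' ∧ d = d' := by
  rw [planeMatrix, planeMatrix, Matrix.fromBlocks_inj] at h
  simpa [funext_iff] using h

theorem IsHyperbolicSystem.nonempty_equiv_symplecticGroup [FiniteDimensional F V]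
    (hs : s.IsAlt) (hnd : s.Nondegenerate) (hb : IsHyperbolicSystem s n e f) {j : ℕ} (hj : j < n)
    {L : Subgroup (Sp s)} (hL : ∀ g, g ∈ L ↔ FixesOffPlane n e f j g) :
    Nonempty (L ≃* Matrix.symplecticGroup (Fin 1) F) := by
  have hef := hb.e_f_self hj
  have hfe : s (f j) (e j) = -1 := by rw [hs.swap, hef]
  have hge : ∀ g : L, (g : Sp s) • e j =
      s ((g : Sp s) • e j) (f j) • e j + s (e j) ((g : Sp s) • e j) • f j := fun g => by
    obtain ⟨a, b, hab⟩ := hb.exists_plane hs hj ((hL g).mp g.2) (v := e j) fun k hk hkj => by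
      simp [hb.e_e, hb.e_f, hk, hj, Ne.symm hkj]
    rw [hab]; simp [hs.self_eq_zero, hef]
  have hgf : ∀ g : L, (g : Sp s) • f j =
      s ((g : Sp s) • f j) (f j) • e j + s (e j) ((g : Sp s) • f j) • f j := fun g => by
    obtain ⟨a, b, hab⟩ := hb.exists_plane hs hj ((hL g).mp g.2) (v := f j) fun k hk hkj => by
      simp [hb.f_e hs, hb.f_f, hk, hj, Ne.symm hkj]
    rw [hab]; simp [hs.self_eq_zero, hef]
  let A : L → Matrix (Fin 1 ⊕ Fin 1) (Fin 1 ⊕ Fin 1) F := fun g =>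
    planeMatrix (s ((g : Sp s) • e j) (f j)) (s ((g : Sp s) • f j) (f j))
      (s (e j) ((g : Sp s) • e j)) (s (e j) ((g : Sp s) • f j))
  have hA : ∀ g : L, A g ∈ Matrix.symplecticGroup (Fin 1) F := fun g => by
    rw [planeMatrix_mem]
    have h1 : s ((g : Sp s) • e j) ((g : Sp s) • f j) = 1 := by rw [Sp.form_smul, hef]
    rw [hge g, hgf g] at h1
    simp only [map_add, map_smul, LinearMap.add_apply, LinearMap.smul_apply, smul_eq_mul,
      hs.self_eq_zero, hef, hfe] at h1
    linear_combination h1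
  have hAmul : ∀ g h : L, A (g * h) = A g * A h := fun g h => by
    have h1 : ((g * h : L) : Sp s) • e j = (s ((h : Sp s) • e j) (f j)) • (g : Sp s) • e j +
        (s (e j) ((h : Sp s) • e j)) • (g : Sp s) • f j := by
      conv_lhs => rw [Subgroup.coe_mul, mul_smul, hge h, smul_add, smul_comm, smul_comm (g : Sp s)]
    have h2 : ((g * h : L) : Sp s) • f j = (s ((h : Sp s) • f j) (f j)) • (g : Sp s) • e j +
        (s (e j) ((h : Sp s) • f j)) • (g : Sp s) • f j := by
      conv_lhs => rw [Subgroup.coe_mul, mul_smul, hgf h, smul_add, smul_comm, smul_comm (g : Sp s)]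
    simp only [A]
    rw [planeMatrix_mul, h1, h2]
    simp only [map_add, map_smul, LinearMap.add_apply, LinearMap.smul_apply, smul_eq_mul]
    congr 1 <;> ring
  let Ψ : L →* Matrix.symplecticGroup (Fin 1) F :=
    MonoidHom.mk' (fun g => ⟨A g, hA g⟩) fun g h => Subtype.ext (hAmul g h)
  refine ⟨MulEquiv.ofBijective Ψ ⟨fun g h hgh => ?_, fun ⟨B, hB⟩ => ?_⟩⟩
  · obtain ⟨h1, h2, h3, h4⟩ := planeMatrix_inj (congrArg Subtype.val hgh)
    refine Subtype.ext (hb.ext_smul fun k hk => ?_)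
    by_cases hkj : k = j
    · subst hkj
      rw [hge g, hge h, hgf g, hgf h, h1, h2, h3, h4]
      exact ⟨rfl, rfl⟩
    · rw [((hL g).mp g.2 k hk hkj).1, ((hL h).mp h.2 k hk hkj).1, ((hL g).mp g.2 k hk hkj).2,
        ((hL h).mp h.2 k hk hkj).2]
      exact ⟨rfl, rfl⟩
  · obtain ⟨a, b, c, d, rfl⟩ := exists_eq_planeMatrix B
    rw [planeMatrix_mem] at hB
    -- The map with `e j ↦ a e j + c f j` and `f j ↦ b e j + d f j` that is the identity on the
    -- orthogonal complement of the plane.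
    let T : V →ₗ[F] V := LinearMap.id + (s.flip (f j)).smulRight ((a - 1) • e j + c • f j) -
      (s.flip (e j)).smulRight (b • e j + (d - 1) • f j)
    have hT : ∀ y, T y = y + s y (f j) • ((a - 1) • e j + c • f j) -
        s y (e j) • (b • e j + (d - 1) • f j) := fun y => by simp [T]
    obtain ⟨g, hg⟩ := Sp.exists_of_isometry hnd T fun y z => by
      rw [hT, hT]
      simp only [map_add, map_sub, map_smul, LinearMap.add_apply, LinearMap.sub_apply,
        LinearMap.smul_apply, smul_eq_mul, hs.self_eq_zero, hef, hfe, hs.swap (e j) z,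
        hs.swap (f j) z]
      linear_combination (s y (f j) * -s z (e j) + s y (e j) * s z (f j)) * hB
    have hg' := fun y => (hg y).trans (hT y)
    have hgL : g ∈ L := (hL g).mpr fun k hk hkj => by
      rw [hg', hg']
      simp [hb.e_e, hb.e_f, hb.f_e hs, hb.f_f, hk, hj, hkj]
    refine ⟨⟨g, hgL⟩, Subtype.ext ?_⟩
    change planeMatrix (s (g • e j) (f j)) (s (g • f j) (f j)) (s (e j) (g • e j))
      (s (e j) (g • f j)) = _
    rw [hg', hg']
    simp [hs.self_eq_zero, hef, hfe]

theorem IsHyperbolicSystem.nonempty_equiv_additive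
    (hs : s.IsAlt) (hb : IsHyperbolicSystem s n e f) {i : ℕ} (hi : i + 1 < n)
    {L : Subgroup (Sp s)} (hL : ∀ g, g ∈ L ↔ FixesOffPair n e f i g) :
    Nonempty (L ≃* Multiplicative (Fin 3 → F)) := by
  have hin : i < n := by omega
  have hadd : ∀ (g h : L) (v : V), ((g * h : L) : Sp s) • v - v =
      ((g : Sp s) • v - v) + ((h : Sp s) • v - v) := fun g h v => by
    have h1 := hb.fixesOffPair_smul hs hi ((hL g).mp g.2) (v := (h : Sp s) • v - v) fun k hk =>
      smul_sub_perp (fun k hk => ((hL h).mp h.2 k hk).1) v hk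
    rw [smul_sub, sub_eq_iff_eq_add] at h1
    rw [Subgroup.coe_mul, mul_smul, h1]
    abel
  -- The entries of the symmetric form `s ((g - 1) v) w` on `⟨f i, f (i + 1)⟩`. They are additive in
  -- `g` because `(g - 1)(h - 1) = 0`.
  let A : L → Fin 3 → F := fun g => ![s ((g : Sp s) • f i - f i) (f i),
    s ((g : Sp s) • f i - f i) (f (i + 1)), s ((g : Sp s) • f (i + 1) - f (i + 1)) (f (i + 1))]
  have hAmul : ∀ g h : L, A (g * h) = A g + A h := fun g h => by
    simp only [A]
    rw [hadd, hadd]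
    simp only [map_add, LinearMap.add_apply]
    ext k
    fin_cases k <;> rfl
  let Ψ : L →* Multiplicative (Fin 3 → F) :=
    MonoidHom.mk' (fun g => Multiplicative.ofAdd (A g)) fun g h =>
      congrArg Multiplicative.ofAdd (hAmul g h)
  refine ⟨MulEquiv.ofBijective Ψ ⟨(injective_iff_map_eq_one Ψ).mpr fun g hg => ?_, fun B => ?_⟩⟩
  · have hA0 : A g = 0 := hg
    have h0 : s ((g : Sp s) • f i - f i) (f i) = 0 := congrFun hA0 0
    have h1 : s ((g : Sp s) • f i - f i) (f (i + 1)) = 0 := congrFun hA0 1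
    have h2 : s ((g : Sp s) • f (i + 1) - f (i + 1)) (f (i + 1)) = 0 := congrFun hA0 2
    have hgL := (hL g).mp g.2
    have hzero : ∀ v : V, s ((g : Sp s) • v - v) (f i) = 0 →
        s ((g : Sp s) • v - v) (f (i + 1)) = 0 → (g : Sp s) • v = v := fun v hv hv' => by
      obtain ⟨a, b, hab⟩ := hb.fixesOffPair_smul_sub hs hi hgL v
      rw [hab] at hv hv'
      simp [hb.e_f, hin, hi] at hv hv'
      rw [hv, hv', zero_smul, zero_smul, add_zero] at hab
      exact sub_eq_zero.mp hab
    have hfi := hzero _ h0 h1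
    have hfi' := hzero (f (i + 1)) (by
      rw [map_sub, LinearMap.sub_apply, sub_eq_zero]
      conv_lhs => rw [← hfi]
      exact Sp.form_smul _ _ _) h2
    refine Subtype.ext (hb.ext_smul fun k hk => ?_)
    rw [Subgroup.coe_one, one_smul, one_smul]
    refine ⟨(hgL k hk).1, ?_⟩
    by_cases hki : k = i
    · rw [hki]; exact hfi
    by_cases hki' : k = i + 1
    · rw [hki']; exact hfi'
    exact (hgL k hk).2 hki hki'
  · obtain ⟨g₀, hg₀⟩ := Sp.exists_transvection hs (e i) (-(B.toAdd 0))
    obtain ⟨g₁, hg₁⟩ := Sp.exists_heisenberg hs (e := e (i + 1)) (v := (-(B.toAdd 1)) • e i)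
      (by rw [map_smul, hb.e_e _ _ hi hin, smul_zero])
    obtain ⟨g₂, hg₂⟩ := Sp.exists_transvection hs (e (i + 1)) (-(B.toAdd 2))
    have hm₀ : g₀ ∈ L := (hL _).mpr fun k hk => ⟨by rw [hg₀]; simp [hb.e_e, hk, hin],
      fun h1 h2 => by rw [hg₀]; simp [hb.f_e hs, hk, hin, h1]⟩
    have hm₁ : g₁ ∈ L := (hL _).mpr (hb.fixesOffPair_of_isHeisenberg hs hi hg₁)
    have hm₂ : g₂ ∈ L := (hL _).mpr (hb.fixesOffPair_of_isTransvection hs hi hg₂)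
    refine ⟨⟨g₀, hm₀⟩ * ⟨g₁, hm₁⟩ * ⟨g₂, hm₂⟩, ?_⟩
    change Multiplicative.ofAdd (A _) = B
    rw [hAmul, hAmul]
    simp only [A]
    rw [hg₀, hg₁, hg₂, hg₀, hg₁, hg₂]
    apply Multiplicative.toAdd.injective
    ext k
    fin_cases k <;> simp [hb.e_f, hb.f_e hs, hin, hi]

end Isomorphisms

/-! ### Passage from a hyperbolic basis to sequences, and the slim amalgam. -/

section Slim

variable {F V : Type*} [Field F] [AddCommGroup V] [Module F V] {s : LinearMap.BilinForm F V}
  {n : ℕ} {b : Module.Basis (Fin n ⊕ Fin n) F V}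

/-- The vectors `e i` of a hyperbolic basis, continued by zero. -/
noncomputable def basisE (b : Module.Basis (Fin n ⊕ Fin n) F V) (i : ℕ) : V :=
  if h : i < n then b (Sum.inl ⟨i, h⟩) else 0

/-- The vectors `f i` of a hyperbolic basis, continued by zero. -/
noncomputable def basisF (b : Module.Basis (Fin n ⊕ Fin n) F V) (i : ℕ) : V :=
  if h : i < n then b (Sum.inr ⟨i, h⟩) else 0

theorem basisE_of_lt {i : ℕ} (h : i < n) : basisE b i = b (Sum.inl ⟨i, h⟩) := dif_pos h

theorem basisF_of_lt {i : ℕ} (h : i < n) : basisF b i = b (Sum.inr ⟨i, h⟩) := dif_pos h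

theorem IsHyperbolicBasis.isHyperbolicSystem (hnd : s.Nondegenerate) (hb : IsHyperbolicBasis s b) :
    IsHyperbolicSystem s n (basisE b) (basisF b) where
  e_e i j hi hj := by rw [basisE_of_lt hi, basisE_of_lt hj, hb.e_e]
  f_f i j hi hj := by rw [basisF_of_lt hi, basisF_of_lt hj, hb.f_f]
  e_f i j hi hj := by
    rw [basisE_of_lt hi, basisF_of_lt hj, hb.e_f]
    simp [Fin.ext_iff]
  separating v hv := hnd.1 v fun w => by
    have : s v = 0 := b.ext fun
      | .inl k => by simpa [basisE_of_lt k.2] using (hv k k.2).1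
      | .inr k => by simpa [basisF_of_lt k.2] using (hv k k.2).2
    rw [this, LinearMap.zero_apply]

theorem mem_basisStabilizer_iff {κ : Type*} {b : Module.Basis κ F V} {T : Set κ}
    {U : Submodule F V} {g : Sp s} :
    g ∈ basisStabilizer s b T U ↔ (∀ k, k ∉ T → g • b k = b k) ∧ g • U = U := by
  rw [basisStabilizer, Subgroup.mem_inf, Subgroup.mem_iInf]
  simp only [Subgroup.mem_iInf, MulAction.mem_stabilizer_iff, Set.mem_compl_iff]

theorem smul_span_eq {g : Sp s} {X : Set V} (h : ∀ x ∈ X, g • x ∈ Submodule.span F X)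
    (h' : ∀ x ∈ X, g⁻¹ • x ∈ Submodule.span F X) :
    g • Submodule.span F X = Submodule.span F X := by
  have key : ∀ g : Sp s, (∀ x ∈ X, g • x ∈ Submodule.span F X) →
      ∀ u ∈ Submodule.span F X, g • u ∈ Submodule.span F X := fun g hg u hu => by
    have : Submodule.span F X ≤ (Submodule.span F X).comap (g : V ≃ₗ[F] V).toLinearMap :=
      Submodule.span_le.mpr hg
    exact this hu
  exact smul_submodule_eq (key g h) (key g⁻¹ h')

/-- Stability of the plane is automatic: it is the orthogonal complement of the remaining basis
vectors, which are fixed. -/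
theorem mem_slimS_iff (hs : s.IsAlt) (hnd : s.Nondegenerate) (hb : IsHyperbolicBasis s b)
    (j : Fin n) (g : Sp s) :
    g ∈ slimS s b j ↔ FixesOffPlane n (basisE b) (basisF b) j g := by
  have hS := hb.isHyperbolicSystem hnd
  rw [slimS, mem_basisStabilizer_iff]
  constructor
  · rintro ⟨h, -⟩ k hk hkj
    rw [basisE_of_lt hk, basisF_of_lt hk]
    exact ⟨h _ (by simp [Fin.ext_iff, hkj]), h _ (by simp [Fin.ext_iff, hkj])⟩
  · intro h
    refine ⟨?_, ?_⟩
    · rintro (k | k) hk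
      · have := (h k k.2 fun hkj => hk (by simp [Fin.ext hkj])).1
        rwa [basisE_of_lt k.2] at this
      · have := (h k k.2 fun hkj => hk (by simp [Fin.ext hkj])).2
        rwa [basisF_of_lt k.2] at this
    · have key : ∀ g : Sp s, FixesOffPlane n (basisE b) (basisF b) j g →
          ∀ x ∈ ({b (Sum.inl j), b (Sum.inr j)} : Set V),
            g • x ∈ Submodule.span F {b (Sum.inl j), b (Sum.inr j)} := by
        intro g hg x hx
        have hx' : ∀ k < n, k ≠ j → s x (basisE b k) = 0 ∧ s x (basisF b k) = 0 := by
          intro k hk hkj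
          have hkj' : j ≠ ⟨k, hk⟩ := fun h => hkj (by rw [h])
          rw [basisE_of_lt hk, basisF_of_lt hk]
          rcases hx with rfl | rfl
          · simp [hb.e_e, hb.e_f, hkj']
          · rw [hs.swap, hb.e_f, hb.f_f]
            simp [hkj'.symm]
        obtain ⟨c, d, hcd⟩ := hS.exists_plane hs j.2 hg hx'
        rw [hcd, basisE_of_lt j.2, basisF_of_lt j.2]
        exact Submodule.mem_span_pair.mpr ⟨c, d, rfl⟩
      refine smul_span_eq (key g h) (key g⁻¹ fun k hk hkj => ?_)
      rw [inv_smul_eq_iff, inv_smul_eq_iff, (h k hk hkj).1, (h k hk hkj).2]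
      exact ⟨rfl, rfl⟩

theorem mem_slimM_iff (hs : s.IsAlt) (hnd : s.Nondegenerate) (hb : IsHyperbolicBasis s b)
    (i : Fin (n - 1)) (g : Sp s) :
    g ∈ slimM s b i ↔ FixesOffPair n (basisE b) (basisF b) i g := by
  have hS := hb.isHyperbolicSystem hnd
  have hi : (i : ℕ) + 1 < n := by omega
  simp only [slimM]
  rw [mem_basisStabilizer_iff]
  constructor
  · rintro ⟨h, -⟩ k hk
    rw [basisE_of_lt hk, basisF_of_lt hk]
    exact ⟨h _ (by simp), fun h1 h2 => h _ (by simp [h1, h2])⟩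
  · intro h
    refine ⟨?_, ?_⟩
    · rintro (k | k) hk
      · have := (h k k.2).1
        rwa [basisE_of_lt k.2] at this
      · have := (h k k.2).2 (fun hki => hk (by simp [Fin.ext_iff, hki]))
          (fun hki => hk (by simp [Fin.ext_iff, hki]))
        rwa [basisF_of_lt k.2] at this
    · have key : ∀ g : Sp s, FixesOffPair n (basisE b) (basisF b) i g → ∀ X : Set V,
          b (Sum.inl ⟨i, by omega⟩) ∈ X → b (Sum.inl ⟨i + 1, by omega⟩) ∈ X →
          ∀ x ∈ X, g • x ∈ Submodule.span F X := by
        intro g hg X h1 h2 x hx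
        obtain ⟨c, d, hcd⟩ := hS.fixesOffPair_smul_sub hs hi hg x
        rw [sub_eq_iff_eq_add.mp hcd, basisE_of_lt hi, basisE_of_lt (show (i : ℕ) < n by omega)]
        exact add_mem (add_mem (Submodule.smul_mem _ _ (Submodule.subset_span h1))
          (Submodule.smul_mem _ _ (Submodule.subset_span h2))) (Submodule.subset_span hx)
      refine smul_span_eq (key g h _ (by simp) (by simp)) (key g⁻¹ (fun k hk => ⟨?_, ?_⟩) _
        (by simp) (by simp))
      · rw [inv_smul_eq_iff, (h k hk).1]
      · intro h1 h2
        rw [inv_smul_eq_iff, (h k hk).2 h1 h2]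

theorem isUniversalCompletion_slimAmalgam (hn : 2 ≤ n) (hs : s.IsAlt) (hnd : s.Nondegenerate)
    (hb : IsHyperbolicBasis s b) (hF : ∀ a b : F, ∃ c, c ≠ a ∧ c ≠ b) :
    IsUniversalCompletion (slimAmalgam s b) := by
  have hS := hb.isHyperbolicSystem hnd
  rw [slimAmalgam]
  obtain ⟨H, hH⟩ : ∃ H, H = Sum.elim (slimM s b) (slimS s b) := ⟨_, rfl⟩
  have hHM : ∀ i, H (Sum.inl i) = slimM s b i := fun i => by rw [hH, Sum.elim_inl]
  have hHS : ∀ j, H (Sum.inr j) = slimS s b j := fun j => by rw [hH, Sum.elim_inr]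
  rw [← hH]
  clear hH
  let L := joinLift H
  let φ := UniversalCompletion.toAmbient (joinAmalgam H)
  let M : ℕ → Subgroup (UniversalCompletion (joinAmalgam H)) := fun i =>
    if h : i < n - 1 then L (Sum.inl ⟨i, h⟩) else ⊥
  let S : ℕ → Subgroup (UniversalCompletion (joinAmalgam H)) := fun j =>
    if h : j < n then L (Sum.inr ⟨j, h⟩) else ⊥
  have hM : ∀ i (h : i + 1 < n), M i = L (Sum.inl ⟨i, by omega⟩) := fun i h => dif_pos (by omega)
  have hSj : ∀ j (h : j < n), S j = L (Sum.inr ⟨j, h⟩) := fun j h => dif_pos h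
  have hl : IsSlimLift φ n (basisE b) (basisF b) M S :=
    { exists_S := fun j hj g hg => by
        rw [hSj j hj]
        refine exists_joinLift H ?_
        rw [hHS]
        exact (mem_slimS_iff hs hnd hb ⟨j, hj⟩ g).mpr hg
      fixes_S := fun j hj x hx => by
        rw [hSj j hj] at hx
        have := toAmbient_mem_of_joinLift H hx
        rw [hHS] at this
        exact (mem_slimS_iff hs hnd hb ⟨j, hj⟩ _).mp this
      exists_M := fun i hi g hg => by
        rw [hM i hi]
        refine exists_joinLift H ?_
        rw [hHM]
        exact (mem_slimM_iff hs hnd hb ⟨i, by omega⟩ g).mpr hg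
      fixes_M := fun i hi x hx => by
        rw [hM i hi] at hx
        have := toAmbient_mem_of_joinLift H hx
        rw [hHM] at this
        exact (mem_slimM_iff hs hnd hb ⟨i, by omega⟩ _).mp this
      inj_SS := fun i hi j hj => by
        rw [hSj i hi, hSj j hj]; exact injectiveOn_joinLift _ _ _
      inj_MM := fun i j hi hj => by
        rw [hM i hi, hM j hj]; exact injectiveOn_joinLift _ _ _
      inj_MS := fun i hi j hj => by
        rw [hM i hi, hSj j hj]; exact injectiveOn_joinLift _ _ _ }
  have hlev := hl.isFaithfulLevel hs hS hF (m := n - 1) (by omega)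
  have hmono : ∀ k m, k ≤ m → liftedLevel M S k ≤ liftedLevel M S m := fun k m hkm => by
    induction hkm with
    | refl => exact le_rfl
    | step _ ih => exact ih.trans (le_sup_left.trans le_sup_left)
  have htop : liftedLevel M S (n - 1) = ⊤ := by
    rw [eq_top_iff, ← iSup_joinLift H, iSup_le_iff]
    rintro (i | j)
    · have := hM i (by omega)
      refine this.ge.trans ?_
      exact (le_sup_right.trans le_sup_left : M i ≤ liftedLevel M S (i + 1)).trans
        (hmono _ _ (by omega))
    · have := hSj j j.2
      refine this.ge.trans ?_
      exact (S_le_liftedLevel _).trans (hmono _ _ (by omega))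
  constructor
  · rw [injective_iff_map_eq_one]
    exact fun x hx => hlev.inj x (htop ▸ Subgroup.mem_top x) hx
  · intro g
    -- At the top level `n - 1` no index lies above, so the fixing condition is vacuous.
    obtain ⟨x, -, hx⟩ := hlev.surj g fun k hk hmk => by omega
    exact ⟨x, hx⟩

end Slim

theorem exists_ne_and_ne_of_two_lt_card {F : Type*} (h : 2 < ENat.card F) (a b : F) :
    ∃ c, c ≠ a ∧ c ≠ b := by
  by_contra! hcon
  have hle : ENat.card F ≤ 2 := by
    rw [← Set.encard_univ]
    have hpair : ({a, b} : Set F).encard ≤ 2 := by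
      refine (Set.encard_insert_le _ _).trans ?_
      rw [Set.encard_singleton, one_add_one_eq_two]
    refine (Set.encard_le_encard (t := {a, b}) fun c _ => ?_).trans hpair
    by_cases hc : c = a
    · exact .inl hc
    · exact .inr (hcon c hc)
  exact absurd h (not_lt.mpr hle)

theorem theorem1p1 {F V : Type*} [Field F] [AddCommGroup V] [Module F V]
    (n : ℕ) (hn : 2 ≤ n) (hV : Module.finrank F V = 2 * n)
    (s : LinearMap.BilinForm F V) (hs_alt : s.IsAlt) (hs_nondeg : s.Nondegenerate) :
    (∀ b : Module.Basis (Fin n ⊕ Fin n) F V, IsHyperbolicBasis s b →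
      (∀ j, Nonempty (slimS s b j ≃* Matrix.symplecticGroup (Fin 1) F)) ∧
      (∀ i, Nonempty (slimM s b i ≃* Multiplicative (Fin 3 → F))) ∧
      (2 < ENat.card F → IsUniversalCompletion (slimAmalgam s b))) ∧
    (∀ C : Set (Submodule F V), IsChamber s C →
      IsUniversalCompletion (parabolicAmalgam s C)) := by
  have : FiniteDimensional F V := FiniteDimensional.of_finrank_pos (by omega)
  refine ⟨fun b hb => ⟨fun j => ?_, fun i => ?_, fun hF => ?_⟩, fun C hC =>
    isUniversalCompletion_parabolicAmalgam hn hV hs_alt hs_nondeg hC⟩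
  · exact (hb.isHyperbolicSystem hs_nondeg).nonempty_equiv_symplecticGroup hs_alt hs_nondeg j.2
      (mem_slimS_iff hs_alt hs_nondeg hb j)
  · exact (hb.isHyperbolicSystem hs_nondeg).nonempty_equiv_additive hs_alt (by omega)
      (mem_slimM_iff hs_alt hs_nondeg hb i)
  · exact isUniversalCompletion_slimAmalgam hn hs_alt hs_nondeg hb
      (exists_ne_and_ne_of_two_lt_card hF)
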